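/- **Setting.** A directed tree $\mathscr T=(V,E)$ is a nonempty directed graph without loops which is connected (as an undirected graph), has no circuits, and in which every vertex that is not a root (a root being a vertex with no incoming edge) has a unique parent $\mathrm{par}(v)$. A directed tree has at most one root. Write $V^\circ$ for the set of non-root vertices, $\mathrm{Chi}(u)$ for the set of children of $u$, $\mathrm{Des}(u)$ for the set of descendants of $u$ (including $u$), and $\mathrm{par}^k$ for the $k$-th iterate of the partial function $\mathrm{par}$. For $\boldsymbol\lambda=\{\lambda_v\}_{v\in V^\circ}\subseteq\mathbb C$, the weighted shift $S_{\boldsymbol\lambda}$ in $\ell^2(V)$ is $(S_{\boldsymbol\lambda}f)(v)=\lambda_v f(\mathrm{par}(v))$ for $v\in V^\circ$ and $(S_{\boldsymbol\lambda}f)(v)=0$ if $v$ is the root. $S_{\boldsymbol\lambda\to(u)}$ is the weighted shift on the subtree with vertex set $\mathrm{Des}(u)$ with weights $\{\lambda_v\}_{v\in \mathrm{Des}(u)\setminus\{u\}}$. The vectors $e_u$ ($u\in V$) are the standard basis of $\ell^2(V)$. A real sequence $\{a_n\}_{n\ge0}$ is completely alternating if $\sum_{j=0}^n(-1)^j\binom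 nj a_{m+j}\le 0$ for all $m\ge 0$, $n\ge1$. Its representing measure is then the unique positive (necessarily finite) Borel measure $\tau$ on $[0,1]$ with $a_n=a_0+\int_0^1(1+s+\dots+s^{n-1})\,d\tau(s)$ for all $n\ge1$. A bounded operator $A$ on a complex Hilbert space $H$ is completely hyperexpansive if $\{\|A^nh\|^2\}_{n\ge0}$ is completely alternating for every $h\in H$. If $\{\|S_{\boldsymbol\lambda}^ne_v\|^2\}_{n\ge0}$ is completely alternating, $\tau_v$ denotes its representing measure. Below, $\frac10=\infty$ and $0\cdot\infty=0$. **Theorem.** Let $\mathscr T$ be a directed tree with a vertex $\omega$ such that $\mathrm{card}\,\mathrm{Chi}(\omega)\ge2$ (possibly infinite) and $\mathrm{card}\,\mathrm{Chi}(v)=1$ for every $v\in V\setminus\{\omega\}$. Let $S_{\boldsymbol\lambda}$ be a bounded (everywhere defined) weighted shift on $\mathscr T$ with nonzero weights $\{\lambda_v\}_{v\in V^\circ}$. (i) If $\omega$ is the root, then $S_{\boldsymbol\lambda}$ is completely hyperexpansive if and only if $\{\|S_{\boldsymbol\lambda}^ne_v\|^2\}_{n\ge0}$ is completely alternating for every $v\in\mathrm{Chi}(\omega)$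 and the consistency condition at $\omega$ holds: $$\sum_{v\in\mathrm{Chi}(\omega)}|\lambda_v|^2\ \ge\ 1+\sum_{v\in\mathrm{Chi}(\omega)}|\lambda_v|^2\int_0^1\frac1s\,d\tau_v(s).$$ (ii) If $\mathscr T$ has a root and $\omega$ is not the root, then there is a unique positive integer $\kappa$ such that $\mathrm{par}^\kappa(\omega)$ is defined and is the root, and the following three conditions are equivalent: - $S_{\boldsymbol\lambda}$ is completely hyperexpansive; - (ii-a) $S_{\boldsymbol\lambda\to(\omega)}$ is completely hyperexpansive, the strong consistency condition at $\omega$ holds, i.e. $\sum_{v\in\mathrm{Chi}(\omega)}|\lambda_v|^2=1+\sum_{v\in\mathrm{Chi}(\omega)}|\lambda_v|^2\int_0^1\frac1s\,d\tau_v(s)$, $$|\lambda_{\mathrm{par}^{k-1}(\omega)}|^2=1+\Big|\prod_{j=0}^{k-1}\lambda_{\mathrm{par}^j(\omega)}\Big|^2\sum_{v\in\mathrm{Chi}(\omega)}|\lambda_v|^2\int_0^1\frac1{s^{k+1}}\,d\tau_v(s)$$ for all integers $k$ with $1\le k\le\kappa-1$, and $$|\lambda_{\mathrm{par}^{\kappa-1}(\omega)}|^2\ge1+\Big|\prod_{j=0}^{\kappa-1}\lambda_{\mathrm{par}^j(\omega)}\Big|^2\sum_{v\in\mathrm{Chi}(\omega)}|\lambda_v|^2\int_0^1\frac1{s^{\kappa+1}}\,d\tau_v(s);$$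 - (ii-b) the sequence $\{\|S_{\boldsymbol\lambda}^ne_{\rm root}\|^2\}_{n\ge0}$ and the sequences $\{\|S_{\boldsymbol\lambda}^ne_v\|^2\}_{n\ge0}$ for all $v\in\mathrm{Chi}(\omega)$ are completely alternating. (iii) If $\mathscr T$ is rootless, then $S_{\boldsymbol\lambda}$ is completely hyperexpansive if and only if $S_{\boldsymbol\lambda}$ is an isometry. -/

import Mathlib

open MeasureTheory
open scoped ENNReal

noncomputable section

/-! ### Directed trees -/

namespace Digraph

variable {V : Type*} (G : Digraph V)

/-- `v` is a root: no edge ends at `v`. -/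
def IsRoot (v : V) : Prop := ∀ u, ¬ G.Adj u v

/-- The set of children of `u`. -/
def children (u : V) : Set V := {v | G.Adj u v}

/-- A circuit: distinct vertices `c 0, …, c n` (at least two of them), with an edge from each to the
next one, and an edge from the last one to the first one. -/
def IsCircuit (n : ℕ) (c : ℕ → V) : Prop :=
  1 ≤ n ∧ Set.InjOn c (Set.Iic n) ∧ (∀ j < n, G.Adj (c j) (c (j + 1))) ∧ G.Adj (c n) (c 0)

/-- A directed tree: a nonempty directed graph without loops which is connected (as an undirected
graph), in which every vertex that is not a root has exactly one parent, and which has no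
circuits. -/
structure IsDirectedTree : Prop where
  nonempty : Nonempty V
  loopless : ∀ v, ¬ G.Adj v v
  connected : ∀ u v, Relation.ReflTransGen (fun a b => G.Adj a b ∨ G.Adj b a) u v
  existsUnique_parent : ∀ v, ¬ G.IsRoot v → ∃! u, G.Adj u v
  no_circuit : ∀ n c, ¬ G.IsCircuit n c

open Classical in
/-- The parent of `v`, when `v` is not a root. (The value `v` at a root is a dummy value:
`ParentIterDefined` says when an iterate is meaningful.) -/
def parent (v : V) : V := if h : ∃ u, G.Adj u v then h.choose else v

/-- The `k`-th iterate of the partial function "parent" is defined at `v`. -/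
def ParentIterDefined (k : ℕ) (v : V) : Prop := ∀ j < k, ¬ G.IsRoot (G.parent^[j] v)

/-- The set of descendants of `u`, including `u`. -/
def descendants (u : V) : Set V := {v | Relation.ReflTransGen G.Adj u v}

/-- The subgraph with vertex set `W`, as a directed graph on the subtype `W`. -/
def restrictTo (W : Set V) : Digraph W where
  Adj a b := G.Adj a b

end Digraph

/-! ### Completely alternating sequences and their representing measures -/

/-- Completely alternating sequences of real numbers. -/
def CompletelyAlternating (a : ℕ → ℝ) : Prop :=
  ∀ m n : ℕ, 1 ≤ n →
    ∑ j ∈ Finset.range (n + 1), (-1 : ℝ) ^ j * (n.choose j : ℝ) * a (m + j) ≤ 0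

/-- `τ` is a (finite, positive) Borel measure on `[0,1]` with
`a n = a 0 + ∫ (1 + s + ⋯ + s ^ (n - 1)) dτ(s)` for all `n ≥ 1`. -/
def IsRepresentingMeasure (a : ℕ → ℝ) (τ : Measure (Set.Icc (0 : ℝ) 1)) : Prop :=
  IsFiniteMeasure τ ∧
    ∀ n : ℕ, 1 ≤ n → a n = a 0 + ∫ s, ∑ j ∈ Finset.range n, (s : ℝ) ^ j ∂τ

open Classical in
/-- The representing measure of a sequence. It exists, and is then unique, exactly when the
sequence is completely alternating; the value `0` for other sequences is a dummy value. -/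
def representingMeasure (a : ℕ → ℝ) : Measure (Set.Icc (0 : ℝ) 1) :=
  if h : ∃ τ, IsRepresentingMeasure a τ then h.choose else 0

/-! ### Weighted shifts on directed trees -/

/-- A bounded operator `A` is completely hyperexpansive if `‖A ^ n h‖ ^ 2` is a completely
alternating sequence for every vector `h`. -/
def IsCompletelyHyperexpansive {H : Type*} [NormedAddCommGroup H] [InnerProductSpace ℂ H]
    (A : H →L[ℂ] H) : Prop :=
  ∀ h : H, CompletelyAlternating fun n => ‖(A ^ n) h‖ ^ 2

/-- The Hilbert space of square summable complex functions on `V`. -/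
abbrev EllTwo (V : Type*) : Type _ := lp (fun _ : V => ℂ) 2

open Classical in
/-- The basis vector at the vertex `u`. -/
def basisVec {V : Type*} (u : V) : EllTwo V := lp.single 2 u (1 : ℂ)

namespace Digraph

variable {V : Type*} (G : Digraph V)

open Classical in
/-- The mapping `f ↦ (v ↦ lam v * f (parent v))`, with value `0` at a root. The value of `lam` at
a root is not used. -/
def shiftFun (lam : V → ℂ) (f : V → ℂ) (v : V) : ℂ :=
  if G.IsRoot v then 0 else lam v * f (G.parent v)

/-- The weighted shift with weights `lam` is defined on all of `ℓ²(V)` and bounded, and it is the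
operator `S`. -/
def IsWeightedShift (lam : V → ℂ) (S : EllTwo V →L[ℂ] EllTwo V) : Prop :=
  ∀ (f : EllTwo V) (v : V), S f v = G.shiftFun lam f v

/-- The weighted shift with the restricted weights on the subtree of descendants of `u` is
completely hyperexpansive (as a bounded operator). -/
def ShiftOnDescendantsCH (lam : V → ℂ) (u : V) : Prop :=
  ∃ T : EllTwo (G.descendants u) →L[ℂ] EllTwo (G.descendants u),
    (G.restrictTo (G.descendants u)).IsWeightedShift (fun v => lam v) T ∧
      IsCompletelyHyperexpansive T

end Digraph

/-- The sequence `‖S ^ n e_u‖ ^ 2`. -/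
def orbitSeq {V : Type*} (S : EllTwo V →L[ℂ] EllTwo V) (u : V) (n : ℕ) : ℝ :=
  ‖(S ^ n) (basisVec u)‖ ^ 2

/-- The representing measure `τ_u` of the sequence `‖S ^ n e_u‖ ^ 2`. -/
def tau {V : Type*} (S : EllTwo V →L[ℂ] EllTwo V) (u : V) : Measure (Set.Icc (0 : ℝ) 1) :=
  representingMeasure (orbitSeq S u)

/-- `∑ |lam v| ^ 2 * ∫ s ^ (-k) dτ_v(s)`, the sum being over the children `v` of `u`, computed in
`[0, ∞]` with `1 / 0 = ∞` and `0 * ∞ = 0`. -/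
def childMoment {V : Type*} (G : Digraph V) (lam : V → ℂ) (S : EllTwo V →L[ℂ] EllTwo V)
    (u : V) (k : ℕ) : ℝ≥0∞ :=
  ∑' v : G.children u, ‖lam v‖ₑ ^ 2 * ∫⁻ s, (ENNReal.ofReal (s : ℝ) ^ k)⁻¹ ∂(tau S v)

/-- The consistency condition at `u`. -/
def ConsistentAt {V : Type*} (G : Digraph V) (lam : V → ℂ) (S : EllTwo V →L[ℂ] EllTwo V)
    (u : V) : Prop :=
  1 + childMoment G lam S u 1 ≤ ∑' v : G.children u, ‖lam v‖ₑ ^ 2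

/-- The strong consistency condition at `u`. -/
def StronglyConsistentAt {V : Type*} (G : Digraph V) (lam : V → ℂ)
    (S : EllTwo V →L[ℂ] EllTwo V) (u : V) : Prop :=
  ∑' v : G.children u, ‖lam v‖ₑ ^ 2 = 1 + childMoment G lam S u 1

end

/-! Since `‖S ^ n f‖² = ∑ |f u|² ‖S ^ n e_u‖²`, complete hyperexpansivity only concerns the
sequences of basis vectors (`isCompletelyHyperexpansive_iff_orbitSeq`). By Hausdorff's moment
theorem, a sequence is completely alternating exactly when its increments are the moments of a
finite measure on `[0,1]`, which is then unique
(`completelyAlternating_iff_exists_isRepresentingMeasure`, `IsRepresentingMeasure.unique`).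

If all children `v` of `u` have measures `τ_v`, then `σ = ∑ |λ_v|² τ_v` represents the sequence of
`u` with its first term dropped. So if `τ_u` exists, then `σ = s dτ_u`
(`childMeasure_eq_withDensity`). Conversely, `τ_u` has to be `s⁻¹ dσ` plus an atom at `0` that
brings the total mass to `‖S e_u‖² - 1`. There is room for this atom exactly under the consistency
condition (`completelyAlternating_of_consistentAt`), and equality means that the atom is absent
(`stronglyConsistentAt_iff`).

If `u` has a parent `p`, then `τ_u` occurs with a positive coefficient in `s dτ_p`, so it cannot
charge `0` and equality is forced (`tau_zero_of_adj`). Climbing from `ω` to the root, each step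
contributes one weight and one more factor `1/s` (`childMoment_iterate_parent`); only at the root
does an inequality suffice.

Without a root, a vertex whose ancestors do not branch lies arbitrarily far along the orbits of its
ancestors, and the decay of increments forces `‖S e_v‖ = 1` (`orbitSeq_one_of_single_children`).
From `ω` this passes down to all descendants (`orbitSeq_child_of_orbitSeq_eq_one`). -/

noncomputable section

/-! ### The Hausdorff moment problem -/

section Moments

open Polynomial Filter Topology

/-- The linear functional on polynomials with moments `b`. -/
def momentFunctional (b : ℕ → ℝ) : ℝ[X] →ₗ[ℝ] ℝ :=
  Polynomial.lsum fun n => b n • LinearMap.id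

@[simp] lemma momentFunctional_X_pow (b : ℕ → ℝ) (n : ℕ) :
    momentFunctional b (X ^ n) = b n := by
  simp [momentFunctional, ← monomial_one_right_eq_X_pow, Polynomial.sum_monomial_index]

lemma momentFunctional_X_pow_mul_one_sub_X_pow (b : ℕ → ℝ) (m n : ℕ) :
    momentFunctional b (X ^ m * (1 - X) ^ n) =
      ∑ j ∈ Finset.range (n + 1), (-1 : ℝ) ^ j * (n.choose j : ℝ) * b (m + j) := by
  have h : (X ^ m * (1 - X) ^ n : ℝ[X]) =
      ∑ j ∈ Finset.range (n + 1), ((-1 : ℝ) ^ j * (n.choose j : ℝ)) • X ^ (m + j) := by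
    rw [sub_eq_neg_add, add_pow, Finset.mul_sum]
    refine Finset.sum_congr rfl fun j _ => ?_
    rw [neg_pow, smul_eq_C_mul]
    simp only [map_mul, map_pow, map_neg, map_one, map_natCast, one_pow, pow_add]
    ring
  rw [h, map_sum]
  simp

/-- Multiplication by `X - 1` is dual to the forward difference. This turns complete alternation of
`a` into complete monotonicity of its increments. -/
lemma momentFunctional_sub_one_mul (a : ℕ → ℝ) (p : ℝ[X]) :
    momentFunctional a ((X - 1) * p) = momentFunctional (fun n => a (n + 1) - a n) p := by
  induction p using Polynomial.induction_on' with
  | add p q hp hq => rw [mul_add, map_add, map_add, hp, hq]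
  | monomial n c =>
    rw [← smul_X_eq_monomial, mul_smul_comm, map_smul, map_smul, sub_mul, one_mul, ← pow_succ',
      map_sub]
    simp

lemma completelyAlternating_iff_momentFunctional (a : ℕ → ℝ) :
    CompletelyAlternating a ↔ ∀ m n : ℕ,
      0 ≤ momentFunctional (fun n => a (n + 1) - a n) (X ^ m * (1 - X) ^ n) := by
  have key : ∀ m n : ℕ, momentFunctional (fun n => a (n + 1) - a n) (X ^ m * (1 - X) ^ n) =
      -momentFunctional a (X ^ m * (1 - X) ^ (n + 1)) := fun m n => by
    rw [← momentFunctional_sub_one_mul, ← map_neg]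
    congr 1
    ring
  constructor
  · intro h m n
    rw [key, momentFunctional_X_pow_mul_one_sub_X_pow]
    linarith [h m (n + 1) (by omega)]
  · intro h m n hn
    obtain ⟨n, rfl⟩ : ∃ k, n = k + 1 := ⟨n - 1, by omega⟩
    have := h m n
    rw [key, momentFunctional_X_pow_mul_one_sub_X_pow] at this
    linarith

/-- Expand `X ^ m = X ^ m * (X + (1 - X)) ^ (N - m)`; the ratios of binomial coefficients are what
remains after factoring out `C(N,k)`. -/
lemma moment_eq_sum_bernstein (b : ℕ → ℝ) (m N : ℕ) (h : m ≤ N) :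
    b m = ∑ k ∈ Finset.range (N + 1), ((k.choose m : ℝ) / (N.choose m : ℝ)) *
      ((N.choose k : ℝ) * momentFunctional b (X ^ k * (1 - X) ^ (N - k))) := by
  obtain ⟨M, rfl⟩ := Nat.exists_eq_add_of_le h
  have h1 : (X ^ m : ℝ[X]) = ∑ i ∈ Finset.range (M + 1),
      (M.choose i : ℝ) • (X ^ (m + i) * (1 - X) ^ (M - i)) := by
    calc (X ^ m : ℝ[X]) = X ^ m * (X + (1 - X)) ^ M := by simp
      _ = _ := by
        rw [add_pow, Finset.mul_sum]
        refine Finset.sum_congr rfl fun i _ => ?_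
        rw [smul_eq_C_mul]
        simp only [map_natCast, pow_add]
        ring
  rw [add_assoc, Finset.sum_range_add, Finset.sum_eq_zero (s := Finset.range m), zero_add,
    ← momentFunctional_X_pow b m, h1, map_sum]
  · refine Finset.sum_congr rfl fun i hi => ?_
    rw [map_smul, smul_eq_mul, show m + M - (m + i) = M - i by omega, ← mul_assoc]
    congr 1
    have hi' : i ≤ M := by simpa [Nat.lt_succ_iff] using hi
    have := Nat.choose_mul (n := m + M) (k := m + i) (s := m) (by omega)
    rw [show m + M - m = M by omega, show m + i - m = i by omega] at this
    have h0 : ((m + M).choose m : ℝ) ≠ 0 := by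
      exact_mod_cast (Nat.choose_pos (by omega)).ne'
    field_simp
    exact_mod_cast (by linarith : M.choose i * (m + M).choose m =
      (m + i).choose m * (m + M).choose (m + i))
  · intro k hk
    rw [Nat.choose_eq_zero_of_lt (by simpa using hk)]
    simp

/-- Passing from `m` to `m + 1` multiplies the ratio by `(k - m) / (N - m)`, which differs from `k /
N` by at most `m / (N - m)`. The bound is uniform in `k`, as needed to compare whole Bernstein sums.
-/
lemma exists_choose_div_sub_pow_le (m : ℕ) : ∃ e : ℕ → ℝ, Tendsto e atTop (𝓝 0) ∧
    ∀ᶠ N : ℕ in atTop, ∀ k : ℕ, k ≤ N →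
      |(k.choose m : ℝ) / (N.choose m : ℝ) - ((k : ℝ) / N) ^ m| ≤ e N := by
  induction m with
  | zero => exact ⟨0, tendsto_const_nhds, Eventually.of_forall fun N k _ => by simp⟩
  | succ m ih =>
    obtain ⟨e, he, h⟩ := ih
    refine ⟨fun N => m / ((N : ℝ) - m) + e N, ?_, ?_⟩
    · have : Tendsto (fun N : ℕ => (m : ℝ) / ((N : ℝ) - m)) atTop (𝓝 0) :=
        Tendsto.div_atTop tendsto_const_nhds
          (tendsto_atTop_add_const_right _ _ tendsto_natCast_atTop_atTop)
      simpa using this.add he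
    · filter_upwards [h, eventually_gt_atTop m] with N hN hmN k hk
      have hN0 : (0 : ℝ) < N := by exact_mod_cast (by omega : 0 < N)
      have hNm : (0 : ℝ) < N - m := by
        have : (m : ℝ) < N := by exact_mod_cast hmN
        linarith
      have hkN : (k : ℝ) ≤ N := by exact_mod_cast hk
      -- Subtraction is real here, so `j < m` is treated apart; both sides then vanish.
      have hc : ∀ j : ℕ, (j.choose (m + 1) : ℝ) * (m + 1) = j.choose m * ((j : ℝ) - m) := by
        intro j
        rcases lt_or_ge j m with hj | hj
        · simp [Nat.choose_eq_zero_of_lt hj, Nat.choose_eq_zero_of_lt (hj.trans (Nat.lt_succ_self m))]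
        · have := Nat.choose_succ_right_eq j m
          rw [← Nat.cast_sub hj]
          exact_mod_cast this
      have hCN : (0 : ℝ) < N.choose m := by exact_mod_cast Nat.choose_pos hmN.le
      have hCN' : (0 : ℝ) < N.choose (m + 1) := by exact_mod_cast Nat.choose_pos hmN
      set g : ℝ := (k.choose m : ℝ) / (N.choose m : ℝ) with hg
      have hstep : (k.choose (m + 1) : ℝ) / (N.choose (m + 1) : ℝ) =
          g * (((k : ℝ) - m) / (N - m)) := by
        have h1 := hc k
        have h2 := hc N
        rw [hg, div_mul_div_comm, div_eq_div_iff hCN'.ne' (by positivity)]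
        have hm1 : (0 : ℝ) < m + 1 := by positivity
        refine mul_right_cancel₀ hm1.ne' ?_
        linear_combination (N.choose m : ℝ) * (N - m) * h1 - (k.choose m : ℝ) * (k - m) * h2
      have hg0 : 0 ≤ g := by positivity
      have hg1 : g ≤ 1 := by
        rw [hg, div_le_one hCN]
        exact_mod_cast Nat.choose_le_choose m hk
      have hx0 : 0 ≤ (k : ℝ) / N := by positivity
      have hx1 : (k : ℝ) / N ≤ 1 := (div_le_one hN0).2 hkN
      have hd : |((k : ℝ) - m) / (N - m) - k / N| ≤ m / ((N : ℝ) - m) := by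
        have : ((k : ℝ) - m) / (N - m) - k / N = -((m / ((N : ℝ) - m)) * (1 - k / N)) := by
          field_simp
          ring
        rw [this, abs_neg, abs_of_nonneg (by apply mul_nonneg; positivity; linarith)]
        exact mul_le_of_le_one_right (by positivity) (by linarith)
      calc _ = |g * (((k : ℝ) - m) / (N - m) - k / N) + (g - ((k : ℝ) / N) ^ m) * (k / N)| := by
            rw [hstep]; congr 1; ring
        _ ≤ |g| * |((k : ℝ) - m) / (N - m) - k / N| + |g - ((k : ℝ) / N) ^ m| * |(k : ℝ) / N| := by
            rw [← abs_mul, ← abs_mul]; exact abs_add_le _ _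
        _ ≤ 1 * (m / ((N : ℝ) - m)) + e N * 1 := by
            rw [abs_of_nonneg hg0, abs_of_nonneg hx0]
            gcongr
            · exact (abs_nonneg _).trans (hN k hk)
            · exact hN k hk
        _ = _ := by ring

/-- The discrete measure on `[0,1]` with the masses `C(N,k) L(X^k (1-X)^(N-k))` at `k / N`. -/
def bernsteinMeasure (b : ℕ → ℝ) (N : ℕ) : Measure (Set.Icc (0 : ℝ) 1) :=
  ∑ k ∈ Finset.range (N + 1),
    ENNReal.ofReal ((N.choose k : ℝ) * momentFunctional b (X ^ k * (1 - X) ^ (N - k))) •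
      Measure.dirac (Set.projIcc (0 : ℝ) 1 zero_le_one ((k : ℝ) / N))

instance (b : ℕ → ℝ) (N : ℕ) : IsFiniteMeasure (bernsteinMeasure b N) := by
  unfold bernsteinMeasure
  have : ∀ k, IsFiniteMeasure (ENNReal.ofReal
      ((N.choose k : ℝ) * momentFunctional b (X ^ k * (1 - X) ^ (N - k))) •
      Measure.dirac (Set.projIcc (0 : ℝ) 1 zero_le_one ((k : ℝ) / N))) := fun k =>
    Measure.smul_finite _ ENNReal.ofReal_ne_top
  infer_instance

lemma integral_bernsteinMeasure {b : ℕ → ℝ}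
    (hb : ∀ m n, 0 ≤ momentFunctional b (X ^ m * (1 - X) ^ n)) (N : ℕ)
    (f : Set.Icc (0 : ℝ) 1 → ℝ) :
    ∫ s, f s ∂(bernsteinMeasure b N) = ∑ k ∈ Finset.range (N + 1),
      f (Set.projIcc (0 : ℝ) 1 zero_le_one ((k : ℝ) / N)) *
        ((N.choose k : ℝ) * momentFunctional b (X ^ k * (1 - X) ^ (N - k))) := by
  unfold bernsteinMeasure
  rw [integral_finsetSum_measure]
  · refine Finset.sum_congr rfl fun k _ => ?_
    rw [integral_smul_measure, integral_dirac, ENNReal.toReal_ofReal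
      (mul_nonneg (Nat.cast_nonneg _) (hb _ _)), smul_eq_mul, mul_comm]
  · intro k _
    exact (integrable_dirac (by simp)).smul_measure ENNReal.ofReal_ne_top

/-- The integral and `b m` are sums over the same nonnegative masses, of total `b 0`, with factors
`(k / N) ^ m` and `C(k,m) / C(N,m)` that are uniformly close. -/
lemma tendsto_integral_bernsteinMeasure {b : ℕ → ℝ}
    (hb : ∀ m n, 0 ≤ momentFunctional b (X ^ m * (1 - X) ^ n)) (m : ℕ) :
    Tendsto (fun N => ∫ s, (s : ℝ) ^ m ∂(bernsteinMeasure b N)) atTop (𝓝 (b m)) := by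
  obtain ⟨e, he, h⟩ := exists_choose_div_sub_pow_le m
  rw [tendsto_iff_norm_sub_tendsto_zero]
  refine squeeze_zero' (g := fun N => e N * b 0) (Eventually.of_forall fun _ => norm_nonneg _) ?_
    (by simpa using he.mul_const (b 0))
  filter_upwards [h, eventually_ge_atTop (max m 1)] with N hN hmN
  have hN0 : (0 : ℝ) < N := by exact_mod_cast (by omega : 0 < N)
  rw [integral_bernsteinMeasure hb N,
    moment_eq_sum_bernstein b m N (by omega), moment_eq_sum_bernstein b 0 N (by omega),
    ← Finset.sum_sub_distrib, Finset.mul_sum]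
  refine (norm_sum_le _ _).trans (Finset.sum_le_sum fun k hk => ?_)
  have hk' : k ≤ N := by simpa [Nat.lt_succ_iff] using hk
  have hkN : (k : ℝ) ≤ N := by exact_mod_cast hk'
  have hp : 0 ≤ (N.choose k : ℝ) * momentFunctional b (X ^ k * (1 - X) ^ (N - k)) :=
    mul_nonneg (Nat.cast_nonneg _) (hb _ _)
  rw [← sub_mul, norm_mul, Real.norm_eq_abs, Real.norm_of_nonneg hp,
    Set.projIcc_of_mem zero_le_one ⟨by positivity, (div_le_one hN0).2 hkN⟩, abs_sub_comm]
  simpa using mul_le_mul_of_nonneg_right (hN k hk') hp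

/-- Probability measures on `[0,1]` form a compact space, so the Bernstein measures converge along
an ultrafilter; the limit inherits the limiting moments. -/
lemma exists_measure_of_moments_of_eq_one {b : ℕ → ℝ} (h0 : b 0 = 1)
    (hb : ∀ m n, 0 ≤ momentFunctional b (X ^ m * (1 - X) ^ n)) :
    ∃ τ : Measure (Set.Icc (0 : ℝ) 1), IsFiniteMeasure τ ∧ ∀ n, ∫ s, (s : ℝ) ^ n ∂τ = b n := by
  have hprob : ∀ N, IsProbabilityMeasure (bernsteinMeasure b N) := fun N => by
    have h1 := integral_bernsteinMeasure hb N (fun _ => (1 : ℝ))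
    have h2 := moment_eq_sum_bernstein b 0 N (by omega)
    simp only [Nat.choose_zero_right, Nat.cast_one, div_one] at h2
    rw [← h2, h0, integral_const, smul_eq_mul, mul_one] at h1
    exact ⟨by rwa [Measure.real, ENNReal.toReal_eq_one_iff] at h1⟩
  let P : ℕ → ProbabilityMeasure (Set.Icc (0 : ℝ) 1) := fun N => ⟨bernsteinMeasure b N, hprob N⟩
  let F : Ultrafilter ℕ := Ultrafilter.of atTop
  obtain ⟨μ, hμ⟩ : ∃ μ, Tendsto P F (𝓝 μ) :=
    ⟨(F.map P).lim, (F.map P).le_nhds_lim⟩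
  refine ⟨μ, inferInstance, fun n => ?_⟩
  have h1 := ProbabilityMeasure.tendsto_iff_forall_integral_tendsto.1 hμ
    (BoundedContinuousFunction.mkOfCompact ⟨fun s : Set.Icc (0 : ℝ) 1 => (s : ℝ) ^ n, by fun_prop⟩)
  exact tendsto_nhds_unique h1
    ((tendsto_integral_bernsteinMeasure hb n).mono_left (Ultrafilter.of_le atTop))

theorem exists_measure_of_moments {b : ℕ → ℝ}
    (hb : ∀ m n, 0 ≤ momentFunctional b (X ^ m * (1 - X) ^ n)) :
    ∃ τ : Measure (Set.Icc (0 : ℝ) 1), IsFiniteMeasure τ ∧ ∀ n, ∫ s, (s : ℝ) ^ n ∂τ = b n := by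
  have hpos : ∀ n, 0 ≤ b n := fun n => by simpa using hb n 0
  have hanti : Antitone b := antitone_nat_of_succ_le fun n => by
    have := hb n 1
    rw [pow_one, mul_sub, mul_one, ← pow_succ, map_sub] at this
    simpa using this
  rcases (hpos 0).eq_or_lt with h0 | h0
  · refine ⟨0, inferInstance, fun n => ?_⟩
    have := hanti (Nat.zero_le n)
    simp only [integral_zero_measure]
    linarith [hpos n]
  · have hsc : momentFunctional (fun n => (b 0)⁻¹ * b n) = (b 0)⁻¹ • momentFunctional b := by
      refine Polynomial.lhom_ext' fun n => ?_
      ext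
      simp [monomial_one_right_eq_X_pow]
    obtain ⟨τ, hτ, h⟩ := exists_measure_of_moments_of_eq_one (b := fun n => (b 0)⁻¹ * b n)
      (by simp [h0.ne']) (fun m n => by
        rw [hsc]
        exact mul_nonneg (inv_nonneg.2 h0.le) (hb m n))
    refine ⟨ENNReal.ofReal (b 0) • τ, Measure.smul_finite _ ENNReal.ofReal_ne_top, fun n => ?_⟩
    rw [integral_smul_measure, h, ENNReal.toReal_ofReal h0.le, smul_eq_mul,
      mul_inv_cancel_left₀ h0.ne']

/-- Equal moments give equal integrals of polynomials, and by Weierstrass polynomials approximate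
every continuous function uniformly on `[0,1]`. -/
theorem measure_ext_of_moments {μ ν : Measure (Set.Icc (0 : ℝ) 1)} [IsFiniteMeasure μ]
    [IsFiniteMeasure ν] (h : ∀ n : ℕ, ∫ s, (s : ℝ) ^ n ∂μ = ∫ s, (s : ℝ) ^ n ∂ν) : μ = ν := by
  have hpoly : ∀ p : ℝ[X], ∫ s : Set.Icc (0 : ℝ) 1, p.eval (s : ℝ) ∂μ =
      ∫ s : Set.Icc (0 : ℝ) 1, p.eval (s : ℝ) ∂ν := fun p => by
    have hint : ∀ (ρ : Measure (Set.Icc (0 : ℝ) 1)) [IsFiniteMeasure ρ] (i : ℕ),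
        Integrable (fun s : Set.Icc (0 : ℝ) 1 => p.coeff i * (s : ℝ) ^ i) ρ := fun ρ _ i =>
      (Continuous.integrable_of_hasCompactSupport (by fun_prop)
        (HasCompactSupport.of_compactSpace _))
    simp only [eval_eq_sum_range]
    rw [integral_finsetSum _ fun i _ => hint μ i, integral_finsetSum _ fun i _ => hint ν i]
    simp only [integral_const_mul, h]
  refine ext_of_forall_integral_eq_of_IsFiniteMeasure fun f => ?_
  have hbound : ∀ ε > 0, ‖∫ s, f s ∂μ - ∫ s, f s ∂ν‖ ≤ ε * (μ.real Set.univ + ν.real Set.univ) := by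
    intro ε hε
    obtain ⟨p, hp⟩ := exists_polynomial_near_continuousMap 0 1 f.toContinuousMap ε hε
    have hp' : ∀ s : Set.Icc (0 : ℝ) 1, ‖f s - p.eval (s : ℝ)‖ ≤ ε := fun s => by
      have := (ContinuousMap.norm_coe_le_norm (p.toContinuousMapOn _ - f.toContinuousMap) s).trans
        hp.le
      rw [norm_sub_rev]
      simpa using this
    have hint : ∀ (ρ : Measure (Set.Icc (0 : ℝ) 1)) [IsFiniteMeasure ρ],
        ‖∫ s, f s ∂ρ - ∫ s : Set.Icc (0 : ℝ) 1, p.eval (s : ℝ) ∂ρ‖ ≤ ε * ρ.real Set.univ :=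
      fun ρ _ => by
        rw [← integral_sub (f.integrable ρ) (Continuous.integrable_of_hasCompactSupport
          (by fun_prop) (HasCompactSupport.of_compactSpace _))]
        exact norm_integral_le_of_norm_le_const (Filter.Eventually.of_forall hp')
    calc ‖∫ s, f s ∂μ - ∫ s, f s ∂ν‖
        = ‖(∫ s, f s ∂μ - ∫ s : Set.Icc (0 : ℝ) 1, p.eval (s : ℝ) ∂μ) -
            (∫ s, f s ∂ν - ∫ s : Set.Icc (0 : ℝ) 1, p.eval (s : ℝ) ∂ν)‖ := by
          rw [hpoly p]; congr 1; ring
      _ ≤ _ := by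
          rw [mul_add]
          exact (norm_sub_le _ _).trans (add_le_add (hint μ) (hint ν))
  rw [← sub_eq_zero, ← norm_le_zero_iff]
  have ht : Tendsto (fun ε : ℝ => ε * (μ.real Set.univ + ν.real Set.univ)) (𝓝[>] 0) (𝓝 0) := by
    have : Tendsto (fun ε : ℝ => ε * (μ.real Set.univ + ν.real Set.univ)) (𝓝 0)
        (𝓝 (0 * (μ.real Set.univ + ν.real Set.univ))) := tendsto_id.mul_const _
    rw [zero_mul] at this
    exact this.mono_left nhdsWithin_le_nhds
  exact ge_of_tendsto ht (eventually_nhdsWithin_of_forall hbound)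

/-! ### Representing measures -/

lemma integrable_pow_unitInterval (τ : Measure (Set.Icc (0 : ℝ) 1)) [IsFiniteMeasure τ] (n : ℕ) :
    Integrable (fun s : Set.Icc (0 : ℝ) 1 => (s : ℝ) ^ n) τ :=
  Continuous.integrable_of_hasCompactSupport (by fun_prop) (HasCompactSupport.of_compactSpace _)

lemma isRepresentingMeasure_iff_integral (a : ℕ → ℝ) (τ : Measure (Set.Icc (0 : ℝ) 1)) :
    IsRepresentingMeasure a τ ↔
      IsFiniteMeasure τ ∧ ∀ n, ∫ s, (s : ℝ) ^ n ∂τ = a (n + 1) - a n := by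
  refine and_congr_right fun _ => ?_
  simp only [integral_finsetSum _ fun i _ => integrable_pow_unitInterval τ i]
  constructor
  · intro h n
    rcases n.eq_zero_or_pos with rfl | hn
    · rw [h 1 le_rfl]; simp
    · rw [h (n + 1) (by omega), h n hn, Finset.sum_range_succ]; ring
  · intro h n _
    simp only [h, Finset.sum_range_sub]
    ring

/-- One direction is the Hausdorff moment theorem for the increments; in the other, the alternating
sums of increments are integrals of `s ^ m * (1 - s) ^ n ≥ 0`. -/
theorem completelyAlternating_iff_exists_isRepresentingMeasure (a : ℕ → ℝ) :
    CompletelyAlternating a ↔ ∃ τ, IsRepresentingMeasure a τ := by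
  simp only [isRepresentingMeasure_iff_integral, completelyAlternating_iff_momentFunctional]
  refine ⟨exists_measure_of_moments, ?_⟩
  rintro ⟨τ, hτ, h⟩ m n
  rw [momentFunctional_X_pow_mul_one_sub_X_pow]
  have : ∑ j ∈ Finset.range (n + 1), (-1 : ℝ) ^ j * (n.choose j : ℝ) *
        (a (m + j + 1) - a (m + j)) =
      ∫ s : Set.Icc (0 : ℝ) 1, (s : ℝ) ^ m * (1 - (s : ℝ)) ^ n ∂τ := by
    simp only [← h]
    simp_rw [← integral_const_mul]
    rw [← integral_finsetSum _ fun i _ => (integrable_pow_unitInterval τ _).const_mul _]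
    refine integral_congr_ae (Eventually.of_forall fun s => ?_)
    dsimp only
    rw [sub_eq_neg_add, add_pow, Finset.mul_sum]
    refine Finset.sum_congr rfl fun j _ => ?_
    rw [neg_pow, pow_add]
    ring
  rw [this]
  exact integral_nonneg fun s =>
    mul_nonneg (pow_nonneg s.2.1 _) (pow_nonneg (sub_nonneg.2 s.2.2) _)

lemma IsRepresentingMeasure.unique {a : ℕ → ℝ} {τ τ' : Measure (Set.Icc (0 : ℝ) 1)}
    (h : IsRepresentingMeasure a τ) (h' : IsRepresentingMeasure a τ') : τ = τ' := by
  rw [isRepresentingMeasure_iff_integral] at h h'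
  have := h.1
  have := h'.1
  exact measure_ext_of_moments fun n => by rw [h.2, h'.2]

lemma CompletelyAlternating.isRepresentingMeasure {a : ℕ → ℝ} (h : CompletelyAlternating a) :
    IsRepresentingMeasure a (representingMeasure a) := by
  have h' := (completelyAlternating_iff_exists_isRepresentingMeasure a).1 h
  rw [representingMeasure, dif_pos h']
  exact h'.choose_spec

lemma ofReal_integral_pow (τ : Measure (Set.Icc (0 : ℝ) 1)) [IsFiniteMeasure τ] (n : ℕ) :
    ENNReal.ofReal (∫ s, (s : ℝ) ^ n ∂τ) = ∫⁻ s, ENNReal.ofReal (s : ℝ) ^ n ∂τ := by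
  rw [ofReal_integral_eq_lintegral_ofReal (integrable_pow_unitInterval τ n)
    (Eventually.of_forall fun s => pow_nonneg s.2.1 n)]
  simp only [fun s : Set.Icc (0 : ℝ) 1 => ENNReal.ofReal_pow s.2.1 n]

lemma lintegral_pow_lt_top (τ : Measure (Set.Icc (0 : ℝ) 1)) [IsFiniteMeasure τ] (n : ℕ) :
    ∫⁻ s, ENNReal.ofReal (s : ℝ) ^ n ∂τ < ∞ := by
  rw [← ofReal_integral_pow]
  exact ENNReal.ofReal_lt_top

/-- The additive form in `[0,∞]` avoids subtraction, so it can be summed over infinitely many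
children without summability side conditions. -/
lemma isRepresentingMeasure_iff_lintegral {a : ℕ → ℝ} (ha : ∀ n, 0 ≤ a n)
    (τ : Measure (Set.Icc (0 : ℝ) 1)) :
    IsRepresentingMeasure a τ ↔ IsFiniteMeasure τ ∧ ∀ n,
      ENNReal.ofReal (a n) + ∫⁻ s, ENNReal.ofReal (s : ℝ) ^ n ∂τ = ENNReal.ofReal (a (n + 1)) := by
  rw [isRepresentingMeasure_iff_integral]
  refine and_congr_right fun _ => forall_congr' fun n => ?_
  have h0 : 0 ≤ ∫ s, (s : ℝ) ^ n ∂τ := integral_nonneg fun s => pow_nonneg s.2.1 n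
  rw [← ofReal_integral_pow, ← ENNReal.ofReal_add (ha n) h0,
    ENNReal.ofReal_eq_ofReal_iff (add_nonneg (ha n) h0) (ha _), eq_sub_iff_add_eq, add_comm]

lemma measure_ext_of_lintegral_pow {μ ν : Measure (Set.Icc (0 : ℝ) 1)} [IsFiniteMeasure μ]
    [IsFiniteMeasure ν]
    (h : ∀ n : ℕ, ∫⁻ s, ENNReal.ofReal (s : ℝ) ^ n ∂μ = ∫⁻ s, ENNReal.ofReal (s : ℝ) ^ n ∂ν) :
    μ = ν := by
  refine measure_ext_of_moments fun n => ?_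
  have := h n
  rwa [← ofReal_integral_pow, ← ofReal_integral_pow, ENNReal.ofReal_eq_ofReal_iff
    (integral_nonneg fun s => pow_nonneg s.2.1 n)
    (integral_nonneg fun s => pow_nonneg s.2.1 n)] at this

end Moments

/-! ### Backward extensions -/

section Backward

/-- The coordinate function on `[0,1]` with values in `[0,∞]`. -/
local notation "crd" => fun s : Set.Icc (0 : ℝ) 1 => ENNReal.ofReal (s : ℝ)

lemma measurable_crd : Measurable crd := by fun_prop

lemma ofReal_coe_eq_zero_iff (s : Set.Icc (0 : ℝ) 1) : ENNReal.ofReal (s : ℝ) = 0 ↔ s = 0 := by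
  rw [ENNReal.ofReal_eq_zero]
  exact ⟨fun h => Subtype.ext (le_antisymm h s.2.1), fun h => by simp [h]⟩

variable {τ σ : Measure (Set.Icc (0 : ℝ) 1)}

lemma eq_withDensity_of_lintegral_pow [IsFiniteMeasure τ] [IsFiniteMeasure σ]
    (h : ∀ n : ℕ, ∫⁻ s, ENNReal.ofReal (s : ℝ) ^ (n + 1) ∂τ =
      ∫⁻ s, ENNReal.ofReal (s : ℝ) ^ n ∂σ) : σ = τ.withDensity crd := by
  have : IsFiniteMeasure (τ.withDensity crd) :=
    isFiniteMeasure_withDensity (by simpa using (lintegral_pow_lt_top τ 1).ne)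
  refine measure_ext_of_lintegral_pow fun n => ?_
  rw [← h, lintegral_withDensity_eq_lintegral_mul _ measurable_crd (by fun_prop)]
  simp only [Pi.mul_apply, pow_succ']

/-- The density cancels one factor `1 / s` away from `0`. At `0` the product is `0 * ∞ = 0`, hence
the restriction to the complement. -/
lemma lintegral_inv_pow_withDensity (k : ℕ) :
    ∫⁻ s, (ENNReal.ofReal (s : ℝ) ^ (k + 1))⁻¹ ∂(τ.withDensity crd) =
      ∫⁻ s in {0}ᶜ, (ENNReal.ofReal (s : ℝ) ^ k)⁻¹ ∂τ := by
  rw [lintegral_withDensity_eq_lintegral_mul _ measurable_crd (by fun_prop),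
    ← lintegral_indicator (measurableSet_singleton _).compl]
  refine lintegral_congr fun s => ?_
  rw [Pi.mul_apply]
  by_cases hs : s = 0
  · simp [hs]
  · have h0 : ENNReal.ofReal (s : ℝ) ≠ 0 := mt (ofReal_coe_eq_zero_iff s).1 hs
    rw [Set.indicator_of_mem (by simpa using hs), pow_succ',
      ENNReal.mul_inv (Or.inl h0) (Or.inl ENNReal.ofReal_ne_top), ← mul_assoc,
      ENNReal.mul_inv_cancel h0 ENNReal.ofReal_ne_top, one_mul]

lemma withDensity_crd_singleton_zero : (τ.withDensity crd) {(0 : Set.Icc (0 : ℝ) 1)} = 0 := by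
  rw [withDensity_apply _ (measurableSet_singleton _), lintegral_singleton]
  simp

/-- Divide `σ` by `s` and place the missing mass `c - ∫ s⁻¹ dσ` at `0`, where no moment of positive
order sees it. -/
lemma exists_backward_extension [IsFiniteMeasure σ] {c : ℝ≥0∞} (hc : c ≠ ∞)
    (h : ∫⁻ s, (ENNReal.ofReal (s : ℝ))⁻¹ ∂σ ≤ c) :
    ∃ τ : Measure (Set.Icc (0 : ℝ) 1), IsFiniteMeasure τ ∧ τ Set.univ = c ∧
      ∀ n : ℕ, ∫⁻ s, ENNReal.ofReal (s : ℝ) ^ (n + 1) ∂τ =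
        ∫⁻ s, ENNReal.ofReal (s : ℝ) ^ n ∂σ := by
  have hfin := (h.trans_lt hc.lt_top).ne
  -- Finiteness of `∫ s⁻¹ dσ` rules out an atom of `σ` at `0`, so `s⁻¹ * s = 1` almost everywhere.
  have hae : ∀ᵐ s : Set.Icc (0 : ℝ) 1 ∂σ, ENNReal.ofReal (s : ℝ) ≠ 0 := by
    filter_upwards [ae_lt_top (by fun_prop) hfin] with s hs h0
    simp [h0] at hs
  have huniv : (σ.withDensity (fun s : Set.Icc (0 : ℝ) 1 => (ENNReal.ofReal (s : ℝ))⁻¹) +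
      (c - ∫⁻ s, (ENNReal.ofReal (s : ℝ))⁻¹ ∂σ) • Measure.dirac (0 : Set.Icc (0 : ℝ) 1))
        Set.univ = c := by
    simp [add_tsub_cancel_of_le h]
  refine ⟨_, ⟨by rw [huniv]; exact hc.lt_top⟩, huniv, fun n => ?_⟩
  rw [lintegral_add_measure, lintegral_smul_measure, lintegral_dirac,
    lintegral_withDensity_eq_lintegral_mul _ (by fun_prop) (by fun_prop)]
  simp only [Set.Icc.coe_zero, ENNReal.ofReal_zero, ne_eq, Nat.add_eq_zero_iff, one_ne_zero,
    and_false, not_false_eq_true, zero_pow, smul_zero, add_zero]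
  refine lintegral_congr_ae (hae.mono fun s hs => ?_)
  rw [Pi.mul_apply, pow_succ', ← mul_assoc, ENNReal.inv_mul_cancel hs ENNReal.ofReal_ne_top,
    one_mul]

end Backward

/-! ### Weighted shifts on directed trees -/

section Shift

variable {V : Type*} {G : Digraph V} {lam : V → ℂ} {S : EllTwo V →L[ℂ] EllTwo V}

lemma EllTwo.enorm_sq_eq_tsum (f : EllTwo V) : ‖f‖ₑ ^ 2 = ∑' v, ‖f v‖ₑ ^ 2 := by
  have h := lp.hasSum_norm (p := 2) (by simp) f
  simp only [ENNReal.toReal_ofNat, Real.rpow_ofNat] at h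
  have h2 := ENNReal.ofReal_tsum_of_nonneg (fun v => by positivity) h.summable
  rw [h.tsum_eq] at h2
  simpa only [ENNReal.ofReal_pow (norm_nonneg _), ofReal_norm] using h2

open Classical in
lemma basisVec_apply (u v : V) : basisVec u v = if v = u then 1 else 0 := by
  simp only [basisVec, lp.coeFn_single, Pi.single_apply]

lemma enorm_basisVec_apply (u v : V) :
    ‖basisVec u v‖ₑ ^ 2 = Set.indicator {u} (fun _ => (1 : ℝ≥0∞)) v := by
  by_cases h : v = u <;> simp [basisVec_apply, h]

lemma norm_basisVec (u : V) : ‖basisVec u‖ = 1 := by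
  simp [basisVec, lp.norm_single]

lemma orbitSeq_nonneg (S : EllTwo V →L[ℂ] EllTwo V) (u : V) (n : ℕ) : 0 ≤ orbitSeq S u n :=
  sq_nonneg _

lemma orbitSeq_zero (S : EllTwo V →L[ℂ] EllTwo V) (u : V) : orbitSeq S u 0 = 1 := by
  simp [orbitSeq, norm_basisVec]

lemma ofReal_orbitSeq (S : EllTwo V →L[ℂ] EllTwo V) (u : V) (n : ℕ) :
    ENNReal.ofReal (orbitSeq S u n) = ‖(S ^ n) (basisVec u)‖ₑ ^ 2 := by
  rw [orbitSeq, ENNReal.ofReal_pow (norm_nonneg _), ofReal_norm]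

namespace Digraph

lemma IsDirectedTree.parent_eq (hG : G.IsDirectedTree) {u v : V} (h : G.Adj u v) :
    G.parent v = u := by
  have hr : ¬ G.IsRoot v := fun hr => hr u h
  have he : ∃ u, G.Adj u v := ⟨u, h⟩
  rw [parent, dif_pos he]
  exact (hG.existsUnique_parent v hr).unique he.choose_spec h

lemma adj_parent {v : V} (h : ¬ G.IsRoot v) : G.Adj (G.parent v) v := by
  have he : ∃ u, G.Adj u v := by simpa [IsRoot] using h
  rw [parent, dif_pos he]
  exact he.choose_spec

lemma IsDirectedTree.shiftFun_of_adj (hG : G.IsDirectedTree) {u v : V} (h : G.Adj u v)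
    (lam f : V → ℂ) : G.shiftFun lam f v = lam v * f u := by
  rw [shiftFun, if_neg (fun hr => hr u h), hG.parent_eq h]

end Digraph

open Digraph

/-- Only the parent of `v` contributes to the sum; this form lets the sums over `u` and `v` be
interchanged. -/
lemma enorm_shift_apply_sq (hG : G.IsDirectedTree) (hS : G.IsWeightedShift lam S) (f : EllTwo V)
    (v : V) : ‖S f v‖ₑ ^ 2 =
      ∑' u, (G.children u).indicator (fun v => ‖lam v‖ₑ ^ 2) v * ‖f u‖ₑ ^ 2 := by
  rw [hS]
  by_cases hr : G.IsRoot v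
  · rw [shiftFun, if_pos hr]
    simp [children, hr _]
  · rw [hG.shiftFun_of_adj (adj_parent hr), tsum_eq_single (G.parent v)]
    · rw [Set.indicator_of_mem (show v ∈ G.children _ from adj_parent hr), enorm_mul, mul_pow]
    · intro u hu
      rw [Set.indicator_of_notMem (show v ∉ G.children u from fun h => hu (hG.parent_eq h).symm), zero_mul]

/-- Write `S ^ (n + 1) f = S ^ n (S f)` and interchange the sums. The second part is the first one,
one power higher, at a basis vector, and it is what feeds the induction. -/
lemma enorm_shift_pow_sq_and (hG : G.IsDirectedTree) (hS : G.IsWeightedShift lam S) (n : ℕ) :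
    (∀ f, ‖(S ^ n) f‖ₑ ^ 2 = ∑' u, ‖f u‖ₑ ^ 2 * ‖(S ^ n) (basisVec u)‖ₑ ^ 2) ∧
    ∀ u, ‖(S ^ (n + 1)) (basisVec u)‖ₑ ^ 2 =
      ∑' v : G.children u, ‖lam v‖ₑ ^ 2 * ‖(S ^ n) (basisVec (v : V))‖ₑ ^ 2 := by
  have hstep : ∀ n : ℕ,
      (∀ f, ‖(S ^ n) f‖ₑ ^ 2 = ∑' u, ‖f u‖ₑ ^ 2 * ‖(S ^ n) (basisVec u)‖ₑ ^ 2) →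
      ∀ f, ‖(S ^ (n + 1)) f‖ₑ ^ 2 = ∑' u, ‖f u‖ₑ ^ 2 *
        ∑' v : G.children u, ‖lam v‖ₑ ^ 2 * ‖(S ^ n) (basisVec (v : V))‖ₑ ^ 2 := by
    intro n h f
    rw [pow_succ S n, ContinuousLinearMap.mul_def, ContinuousLinearMap.comp_apply, h]
    simp only [enorm_shift_apply_sq hG hS, ← ENNReal.tsum_mul_right]
    rw [ENNReal.tsum_comm]
    refine tsum_congr fun u => ?_
    rw [← ENNReal.tsum_mul_left, tsum_subtype (G.children u) fun v => ‖f u‖ₑ ^ 2 *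
      (‖lam v‖ₑ ^ 2 * ‖(S ^ n) (basisVec (v : V))‖ₑ ^ 2)]
    refine tsum_congr fun v => ?_
    by_cases hv : v ∈ G.children u
    · simp only [Set.indicator_of_mem hv]; ring
    · simp only [Set.indicator_of_notMem hv, zero_mul]
  have hbasis : ∀ (g : V → ℝ≥0∞) (u : V), ∑' v, ‖basisVec u v‖ₑ ^ 2 * g v = g u := by
    intro g u
    rw [tsum_eq_single u]
    · simp [enorm_basisVec_apply]
    · intro v hv
      simp [enorm_basisVec_apply, hv]
  have hsucc : ∀ n : ℕ,
      (∀ f, ‖(S ^ n) f‖ₑ ^ 2 = ∑' u, ‖f u‖ₑ ^ 2 * ‖(S ^ n) (basisVec u)‖ₑ ^ 2) →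
      ∀ u, ‖(S ^ (n + 1)) (basisVec u)‖ₑ ^ 2 =
        ∑' v : G.children u, ‖lam v‖ₑ ^ 2 * ‖(S ^ n) (basisVec (v : V))‖ₑ ^ 2 := fun n h u => by
    rw [hstep n h, hbasis]
  have hmain : ∀ f, ‖(S ^ n) f‖ₑ ^ 2 = ∑' u, ‖f u‖ₑ ^ 2 * ‖(S ^ n) (basisVec u)‖ₑ ^ 2 := by
    induction n with
    | zero =>
      intro f
      have : ∀ u : V, ‖basisVec u‖ₑ = 1 := fun u => by
        rw [← ofReal_norm, norm_basisVec, ENNReal.ofReal_one]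
      simp [EllTwo.enorm_sq_eq_tsum f, this]
    | succ n ih =>
      intro f
      rw [hstep n ih]
      simp only [hsucc n ih]
  exact ⟨hmain, hsucc n hmain⟩

lemma enorm_shift_pow_sq (hG : G.IsDirectedTree) (hS : G.IsWeightedShift lam S) (n : ℕ)
    (f : EllTwo V) :
    ‖(S ^ n) f‖ₑ ^ 2 = ∑' u, ‖f u‖ₑ ^ 2 * ENNReal.ofReal (orbitSeq S u n) := by
  simp only [ofReal_orbitSeq]
  exact (enorm_shift_pow_sq_and hG hS n).1 f

lemma orbitSeq_succ (hG : G.IsDirectedTree) (hS : G.IsWeightedShift lam S) (n : ℕ) (u : V) :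
    ENNReal.ofReal (orbitSeq S u (n + 1)) =
      ∑' v : G.children u, ‖lam v‖ₑ ^ 2 * ENNReal.ofReal (orbitSeq S v n) := by
  simp only [ofReal_orbitSeq]
  exact (enorm_shift_pow_sq_and hG hS n).2 u

lemma hasSum_norm_shift_pow_sq (hG : G.IsDirectedTree) (hS : G.IsWeightedShift lam S) (n : ℕ)
    (f : EllTwo V) : HasSum (fun u => ‖f u‖ ^ 2 * orbitSeq S u n) (‖(S ^ n) f‖ ^ 2) := by
  have h := enorm_shift_pow_sq hG hS n f
  have key : ∀ (g : V → ℝ≥0∞) (c : ℝ≥0∞), c ≠ ∞ → c = ∑' u, g u →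
      HasSum (fun u => (g u).toReal) c.toReal := fun g c hc hg => by
    subst hg
    rw [ENNReal.tsum_toReal_eq (ENNReal.ne_top_of_tsum_ne_top hc)]
    exact ENNReal.hasSum_toReal hc
  have h2 := key _ _ (by simp) h
  simpa [ENNReal.toReal_mul, ENNReal.toReal_ofReal (orbitSeq_nonneg _ _ _)] using h2

lemma CompletelyAlternating.of_hasSum {ι : Type*} {a : ι → ℕ → ℝ} {c : ι → ℝ} {b : ℕ → ℝ}
    (ha : ∀ i, CompletelyAlternating (a i)) (hc : ∀ i, 0 ≤ c i)
    (hb : ∀ n, HasSum (fun i => c i * a i n) (b n)) : CompletelyAlternating b := by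
  intro m n hn
  have h1 : HasSum (fun i => c i * ∑ j ∈ Finset.range (n + 1),
      (-1 : ℝ) ^ j * (n.choose j : ℝ) * a i (m + j))
      (∑ j ∈ Finset.range (n + 1), (-1 : ℝ) ^ j * (n.choose j : ℝ) * b (m + j)) := by
    have h2 := hasSum_sum (s := Finset.range (n + 1)) fun j _ =>
      (hb (m + j)).mul_left ((-1 : ℝ) ^ j * (n.choose j : ℝ))
    refine (funext fun i => ?_ : _ = fun i => _) ▸ h2
    rw [Finset.mul_sum]
    exact Finset.sum_congr rfl fun j _ => by ring
  exact h1.nonpos fun i => mul_nonpos_of_nonneg_of_nonpos (hc i) (ha i m n hn)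

lemma isCompletelyHyperexpansive_iff_orbitSeq (hG : G.IsDirectedTree)
    (hS : G.IsWeightedShift lam S) :
    IsCompletelyHyperexpansive S ↔ ∀ u, CompletelyAlternating (orbitSeq S u) :=
  ⟨fun h u => h (basisVec u), fun h f =>
    CompletelyAlternating.of_hasSum h (fun u => sq_nonneg ‖f u‖)
      fun n => hasSum_norm_shift_pow_sq hG hS n f⟩

end Shift

/-! ### Consistency conditions -/

section Consistency

open Digraph

variable {V : Type*} {G : Digraph V} {lam : V → ℂ} {S : EllTwo V →L[ℂ] EllTwo V} {u : V}

lemma isRepresentingMeasure_tau (h : CompletelyAlternating (orbitSeq S u)) :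
    IsFiniteMeasure (tau S u) ∧ ∀ n, ENNReal.ofReal (orbitSeq S u n) +
      ∫⁻ s, ENNReal.ofReal (s : ℝ) ^ n ∂(tau S u) = ENNReal.ofReal (orbitSeq S u (n + 1)) :=
  (isRepresentingMeasure_iff_lintegral (orbitSeq_nonneg S u) _).1 h.isRepresentingMeasure

/-- The sum of the measures `|lam v| ^ 2 τ_v` over the children `v` of `u`. -/
def childMeasure (G : Digraph V) (lam : V → ℂ) (S : EllTwo V →L[ℂ] EllTwo V) (u : V) :
    Measure (Set.Icc (0 : ℝ) 1) :=
  Measure.sum fun v : G.children u => ‖lam v‖ₑ ^ 2 • tau S v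

lemma lintegral_childMeasure (u : V) (f : Set.Icc (0 : ℝ) 1 → ℝ≥0∞) :
    ∫⁻ s, f s ∂(childMeasure G lam S u) =
      ∑' v : G.children u, ‖lam v‖ₑ ^ 2 * ∫⁻ s, f s ∂(tau S v) := by
  rw [childMeasure, lintegral_sum_measure]
  simp only [lintegral_smul_measure, smul_eq_mul]

lemma childMoment_eq_lintegral (u : V) (k : ℕ) : childMoment G lam S u k =
    ∫⁻ s, (ENNReal.ofReal (s : ℝ) ^ k)⁻¹ ∂(childMeasure G lam S u) := by
  rw [lintegral_childMeasure, childMoment]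

variable (hG : G.IsDirectedTree) (hS : G.IsWeightedShift lam S)
include hG hS

lemma tsum_enorm_weight_sq (u : V) :
    ∑' v : G.children u, ‖lam v‖ₑ ^ 2 = ENNReal.ofReal (orbitSeq S u 1) := by
  rw [orbitSeq_succ hG hS 0 u]
  simp [orbitSeq_zero]

/-- Summing the children's recursions with weights `|λ_v|²` shows that `childMeasure` governs the
increments of the sequence of `u` from index `1` on. -/
lemma orbitSeq_add_lintegral_childMeasure
    (hch : ∀ v ∈ G.children u, CompletelyAlternating (orbitSeq S v)) (n : ℕ) :
    ENNReal.ofReal (orbitSeq S u (n + 1)) +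
      ∫⁻ s, ENNReal.ofReal (s : ℝ) ^ n ∂(childMeasure G lam S u) =
        ENNReal.ofReal (orbitSeq S u (n + 2)) := by
  rw [lintegral_childMeasure, orbitSeq_succ hG hS, orbitSeq_succ hG hS, ← ENNReal.tsum_add]
  refine tsum_congr fun v => ?_
  rw [← mul_add, (isRepresentingMeasure_tau (hch v v.2)).2]

lemma isFiniteMeasure_childMeasure
    (hch : ∀ v ∈ G.children u, CompletelyAlternating (orbitSeq S v)) :
    IsFiniteMeasure (childMeasure G lam S u) := by
  have h := orbitSeq_add_lintegral_childMeasure hG hS hch 0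
  simp only [pow_zero, lintegral_const, one_mul] at h
  refine ⟨lt_of_le_of_lt ?_ (ENNReal.ofReal_lt_top (r := orbitSeq S u (0 + 2)))⟩
  rw [← h]
  exact le_add_self

/-- The moment of order `n` of the left side and that of order `n + 1` of `tau S u` are the same
increment, and moments determine the measure. -/
lemma childMeasure_eq_withDensity
    (hch : ∀ v ∈ G.children u, CompletelyAlternating (orbitSeq S v))
    (hu : CompletelyAlternating (orbitSeq S u)) :
    childMeasure G lam S u = (tau S u).withDensity fun s => ENNReal.ofReal (s : ℝ) := by
  have := isFiniteMeasure_childMeasure hG hS hch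
  obtain ⟨_, hτ⟩ := isRepresentingMeasure_tau hu
  refine eq_withDensity_of_lintegral_pow fun n => ?_
  rw [← ENNReal.add_right_inj (ENNReal.ofReal_ne_top (r := orbitSeq S u (n + 1))), hτ,
    orbitSeq_add_lintegral_childMeasure hG hS hch]

lemma childMoment_succ
    (hch : ∀ v ∈ G.children u, CompletelyAlternating (orbitSeq S v))
    (hu : CompletelyAlternating (orbitSeq S u)) (k : ℕ) :
    childMoment G lam S u (k + 1) =
      ∫⁻ s in {0}ᶜ, (ENNReal.ofReal (s : ℝ) ^ k)⁻¹ ∂(tau S u) := by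
  rw [childMoment_eq_lintegral, childMeasure_eq_withDensity hG hS hch hu,
    lintegral_inv_pow_withDensity]

lemma childMoment_succ_of_tau_zero
    (hch : ∀ v ∈ G.children u, CompletelyAlternating (orbitSeq S v))
    (hu : CompletelyAlternating (orbitSeq S u)) (h0 : tau S u {0} = 0) (k : ℕ) :
    childMoment G lam S u (k + 1) = ∫⁻ s, (ENNReal.ofReal (s : ℝ) ^ k)⁻¹ ∂(tau S u) := by
  rw [childMoment_succ hG hS hch hu, Measure.restrict_eq_self_of_ae_mem]
  exact measure_eq_zero_iff_ae_notMem.1 h0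

/-- The total mass of `tau S u` is `‖S e_u‖² - 1`; split it into the part off `0`, which is the
child moment, and the atom at `0`. The slack in the consistency condition is thus exactly this atom.
-/
lemma tsum_enorm_weight_sq_eq
    (hch : ∀ v ∈ G.children u, CompletelyAlternating (orbitSeq S v))
    (hu : CompletelyAlternating (orbitSeq S u)) :
    ∑' v : G.children u, ‖lam v‖ₑ ^ 2 = 1 + childMoment G lam S u 1 + tau S u {0} := by
  have h := (isRepresentingMeasure_tau hu).2 0
  rw [tsum_enorm_weight_sq hG hS, ← h, childMoment_succ hG hS hch hu]
  simp only [pow_zero, inv_one, lintegral_const, one_mul, orbitSeq_zero, ENNReal.ofReal_one,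
    Measure.restrict_apply_univ, add_assoc]
  rw [add_comm (tau S u {0}ᶜ), measure_add_measure_compl (measurableSet_singleton _)]

lemma consistentAt_of_completelyAlternating
    (hch : ∀ v ∈ G.children u, CompletelyAlternating (orbitSeq S v))
    (hu : CompletelyAlternating (orbitSeq S u)) : ConsistentAt G lam S u := by
  rw [ConsistentAt, tsum_enorm_weight_sq_eq hG hS hch hu]
  exact le_self_add

lemma stronglyConsistentAt_iff
    (hch : ∀ v ∈ G.children u, CompletelyAlternating (orbitSeq S v))
    (hu : CompletelyAlternating (orbitSeq S u)) :
    StronglyConsistentAt G lam S u ↔ tau S u {0} = 0 := by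
  have h := tsum_enorm_weight_sq_eq hG hS hch hu
  -- Finiteness permits cancellation in `[0,∞]`.
  have hfin : 1 + childMoment G lam S u 1 ≠ ∞ := by
    refine ne_top_of_le_ne_top ?_ (consistentAt_of_completelyAlternating hG hS hch hu)
    rw [tsum_enorm_weight_sq hG hS]
    exact ENNReal.ofReal_ne_top
  rw [StronglyConsistentAt, h]
  constructor
  · intro h'
    refine (ENNReal.add_right_inj hfin).1 ?_
    rw [h', add_zero]
  · intro h'
    rw [h', add_zero]

lemma completelyAlternating_of_consistentAt
    (hch : ∀ v ∈ G.children u, CompletelyAlternating (orbitSeq S v))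
    (hc : ConsistentAt G lam S u) : CompletelyAlternating (orbitSeq S u) := by
  have := isFiniteMeasure_childMeasure hG hS hch
  rw [ConsistentAt, tsum_enorm_weight_sq hG hS, childMoment_eq_lintegral] at hc
  simp only [pow_one] at hc
  -- The total mass has to be the first increment `‖S e_u‖² - 1`.
  obtain ⟨τ, hτ, hτ0, hτs⟩ := exists_backward_extension (σ := childMeasure G lam S u)
    (c := ENNReal.ofReal (orbitSeq S u 1) - 1) (ENNReal.sub_ne_top ENNReal.ofReal_ne_top)
    (ENNReal.le_sub_of_add_le_left ENNReal.one_ne_top hc)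
  rw [completelyAlternating_iff_exists_isRepresentingMeasure]
  refine ⟨τ, (isRepresentingMeasure_iff_lintegral (orbitSeq_nonneg S u) τ).2 ⟨hτ, fun n => ?_⟩⟩
  cases n with
  | zero =>
    simp only [pow_zero, lintegral_const, one_mul, hτ0, orbitSeq_zero, ENNReal.ofReal_one]
    exact add_tsub_cancel_of_le (le_self_add.trans hc)
  | succ n => rw [hτs, orbitSeq_add_lintegral_childMeasure hG hS hch]

/-- The combined measure of all children of `p` has density `s` with respect to `tau S p`, so it
does not charge `0`; hence neither does any summand with nonzero weight. -/
lemma tau_zero_of_adj {p : V} (hpu : G.Adj p u) (hu : lam u ≠ 0)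
    (hch : ∀ v ∈ G.children p, CompletelyAlternating (orbitSeq S v))
    (hp : CompletelyAlternating (orbitSeq S p)) : tau S u {0} = 0 := by
  have h : childMeasure G lam S p {0} = 0 := by
    rw [childMeasure_eq_withDensity hG hS hch hp, withDensity_crd_singleton_zero]
  rw [childMeasure, Measure.sum_apply _ (measurableSet_singleton _), ENNReal.tsum_eq_zero] at h
  have := h ⟨u, hpu⟩
  rw [Measure.smul_apply, smul_eq_mul, mul_eq_zero] at this
  exact this.resolve_left (by simpa using hu)

lemma stronglyConsistentAt_of_adj {p : V} (hpu : G.Adj p u) (hu : lam u ≠ 0)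
    (hCA : ∀ v, CompletelyAlternating (orbitSeq S v)) : StronglyConsistentAt G lam S u :=
  (stronglyConsistentAt_iff hG hS (fun v _ => hCA v) (hCA u)).2
    (tau_zero_of_adj hG hS hpu hu (fun v _ => hCA v) (hCA p))

omit hG hS in
lemma tsum_children_of_eq_singleton {v : V} (huv : G.children u = {v}) (f : V → ℝ≥0∞) :
    ∑' x : G.children u, f x = f v := by
  rw [huv, tsum_singleton]

lemma orbitSeq_succ_of_children_eq_singleton {v : V} (huv : G.children u = {v}) (n : ℕ) :
    orbitSeq S u (n + 1) = ‖lam v‖ ^ 2 * orbitSeq S v n := by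
  have h := orbitSeq_succ hG hS n u
  rw [tsum_children_of_eq_singleton huv fun x => ‖lam x‖ₑ ^ 2 * ENNReal.ofReal (orbitSeq S x n),
    ← ofReal_norm, ← ENNReal.ofReal_pow (norm_nonneg _), ← ENNReal.ofReal_mul (sq_nonneg _),
    ENNReal.ofReal_eq_ofReal_iff (orbitSeq_nonneg _ _ _)
      (mul_nonneg (sq_nonneg _) (orbitSeq_nonneg _ _ _))] at h
  exact h

lemma completelyAlternating_child {v : V} (huv : G.children u = {v}) (hv : lam v ≠ 0)
    (hu : CompletelyAlternating (orbitSeq S u)) : CompletelyAlternating (orbitSeq S v) := by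
  intro m n hn
  have h := hu (m + 1) n hn
  simp only [add_right_comm m 1, orbitSeq_succ_of_children_eq_singleton hG hS huv] at h
  have h2 : 0 < ‖lam v‖ ^ 2 := by positivity
  refine nonpos_of_mul_nonpos_right (a := ‖lam v‖ ^ 2) ?_ h2
  rw [Finset.mul_sum]
  refine (Finset.sum_congr rfl fun j _ => ?_).trans_le h
  ring

omit hG hS in
lemma childMoment_of_children_eq_singleton {v : V} (huv : G.children u = {v}) (k : ℕ) :
    childMoment G lam S u k =
      ‖lam v‖ₑ ^ 2 * ∫⁻ s, (ENNReal.ofReal (s : ℝ) ^ k)⁻¹ ∂(tau S v) :=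
  tsum_children_of_eq_singleton huv fun x =>
    ‖lam x‖ₑ ^ 2 * ∫⁻ s, (ENNReal.ofReal (s : ℝ) ^ k)⁻¹ ∂(tau S x)

omit hG hS in
-- Going up one unbranched vertex multiplies by one squared weight and, when the measure below has
-- no atom at `0`, raises the exponent of `1 / s` by one.
lemma childMoment_iterate_parent {ω : V} {k : ℕ}
    (hsing : ∀ j < k, G.children (G.parent^[j + 1] ω) = {G.parent^[j] ω})
    (hmom : ∀ j < k, ∀ m, childMoment G lam S (G.parent^[j] ω) (m + 1) =
      ∫⁻ s, (ENNReal.ofReal (s : ℝ) ^ m)⁻¹ ∂(tau S (G.parent^[j] ω))) (m : ℕ) :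
    childMoment G lam S (G.parent^[k] ω) m =
      ‖∏ j ∈ Finset.range k, lam (G.parent^[j] ω)‖ₑ ^ 2 * childMoment G lam S ω (k + m) := by
  induction k generalizing m with
  | zero => simp
  | succ k ih =>
    rw [childMoment_of_children_eq_singleton (hsing k (by omega)), ← hmom k (by omega),
      ih (fun j hj => hsing j (by omega)) (fun j hj => hmom j (by omega)),
      Finset.prod_range_succ, enorm_mul, mul_pow, show k + (m + 1) = k + 1 + m by omega]
    ring

end Consistency

/-! ### Structure of directed trees -/

namespace Digraph

open Function

variable {V : Type*} {G : Digraph V}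

/-- Follow an undirected path from `r`. An edge traversed backwards leads to the unique parent,
which already precedes the current vertex on the directed path; at `r` such an edge is impossible.
-/
lemma IsDirectedTree.reflTransGen_root (hG : G.IsDirectedTree) {r : V} (hr : G.IsRoot r) (v : V) :
    Relation.ReflTransGen G.Adj r v := by
  induction hG.connected r v with
  | refl => exact .refl
  | @tail b c _ hbc ih =>
    rcases hbc with h | h
    · exact ih.tail h
    · rcases Relation.ReflTransGen.cases_tail ih with rfl | ⟨d, hd, hdb⟩
      · exact absurd h (hr c)
      · rwa [← hG.parent_eq h, hG.parent_eq hdb]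

lemma ParentIterDefined.mono {k l : ℕ} {v : V} (h : G.ParentIterDefined l v) (hkl : k ≤ l) :
    G.ParentIterDefined k v := fun j hj => h j (hj.trans_le hkl)

lemma ParentIterDefined.adj {k j : ℕ} {v : V} (h : G.ParentIterDefined k v) (hj : j < k) :
    G.Adj (G.parent^[j + 1] v) (G.parent^[j] v) := by
  rw [iterate_succ_apply']
  exact adj_parent (h j hj)

lemma ParentIterDefined.transGen {k : ℕ} {v : V} (h : G.ParentIterDefined (k + 1) v) :
    Relation.TransGen G.Adj (G.parent^[k + 1] v) v := by
  induction k with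
  | zero => exact .single (h.adj (Nat.lt_succ_self 0))
  | succ k ih => exact .head (h.adj (Nat.lt_succ_self _)) (ih (h.mono (Nat.le_succ _)))

lemma ParentIterDefined.succ_of_adj (hG : G.IsDirectedTree) {u v : V} (huv : G.Adj u v) {k : ℕ}
    (h : G.ParentIterDefined k u) : G.ParentIterDefined (k + 1) v := by
  intro j hj
  cases j with
  | zero => exact fun hr => hr u huv
  | succ j =>
    rw [iterate_succ_apply, hG.parent_eq huv]
    exact h j (by omega)

lemma IsDirectedTree.exists_parent_iterate_eq (hG : G.IsDirectedTree) {u v : V}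
    (h : Relation.ReflTransGen G.Adj u v) :
    ∃ k, G.ParentIterDefined k v ∧ G.parent^[k] v = u := by
  induction h with
  | refl => exact ⟨0, fun j hj => absurd hj (by omega), rfl⟩
  | @tail b c _ hbc ih =>
    obtain ⟨k, hk, rfl⟩ := ih
    exact ⟨k + 1, hk.succ_of_adj hG hbc, by rw [iterate_succ_apply, hG.parent_eq hbc]⟩

/-- A closed directed walk makes `v` periodic under `parent`. The minimal period gives distinct
vertices, hence a circuit, and period one would be a loop. -/
lemma IsDirectedTree.not_transGen_self (hG : G.IsDirectedTree) (v : V) :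
    ¬ Relation.TransGen G.Adj v v := by
  intro h
  obtain ⟨c, hvc, hcv⟩ := Relation.TransGen.tail'_iff.1 h
  obtain ⟨k, hk, hkv⟩ := hG.exists_parent_iterate_eq hvc
  have hdef := hk.succ_of_adj hG hcv
  have hper : IsPeriodicPt G.parent (k + 1) v := by
    rw [IsPeriodicPt, IsFixedPt, iterate_succ_apply, hG.parent_eq hcv, hkv]
  set p := minimalPeriod G.parent v with hp
  have hp0 : 0 < p := hper.minimalPeriod_pos (Nat.succ_pos k)
  have hpk : p ≤ k + 1 := hper.minimalPeriod_le (Nat.succ_pos k)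
  have hpv : G.parent^[p] v = v := iterate_minimalPeriod
  have hp1 : p ≠ 1 := fun h1 => by
    rw [h1, iterate_one, hG.parent_eq hcv] at hpv
    exact hG.loopless v (hpv ▸ hcv)
  -- The orbit is listed in reverse because `parent` runs against the edges.
  refine hG.no_circuit (p - 1) (fun j => G.parent^[p - 1 - j] v) ⟨by omega, ?_, ?_, ?_⟩
  · intro i hi j hj hij
    have := iterate_injOn_Iio_minimalPeriod (f := G.parent) (x := v)
      (show p - 1 - i ∈ Set.Iio (minimalPeriod G.parent v) by rw [← hp, Set.mem_Iio]; omega)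
      (show p - 1 - j ∈ Set.Iio (minimalPeriod G.parent v) by rw [← hp, Set.mem_Iio]; omega) hij
    rw [Set.mem_Iic] at hi hj
    omega
  · intro j hj
    have := hdef.adj (j := p - 1 - (j + 1)) (by omega)
    rwa [show p - 1 - (j + 1) + 1 = p - 1 - j by omega] at this
  · have := hdef.adj (j := p - 1) (by omega)
    rw [show p - 1 + 1 = p by omega, hpv] at this
    simpa using this

lemma IsDirectedTree.existsUnique_depth (hG : G.IsDirectedTree) {r v : V} (hr : G.IsRoot r)
    (hv : v ≠ r) : ∃! κ : ℕ, 0 < κ ∧ G.ParentIterDefined κ v ∧ G.parent^[κ] v = r := by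
  obtain ⟨κ, hκ, hκr⟩ := hG.exists_parent_iterate_eq (hG.reflTransGen_root hr v)
  refine ⟨κ, ⟨Nat.pos_of_ne_zero ?_, hκ, hκr⟩, ?_⟩
  · rintro rfl
    exact hv hκr
  · rintro l ⟨-, hl, hlr⟩
    rcases lt_trichotomy l κ with h | h | h
    · exact absurd (hlr ▸ hr) (hκ l h)
    · exact h
    · exact absurd (hκr ▸ hr) (hl κ h)

lemma children_eq_singleton {u v : V} (h : (G.children u).encard = 1) (huv : G.Adj u v) :
    G.children u = {v} := by
  obtain ⟨w, hw⟩ := Set.encard_eq_one.1 h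
  have : v ∈ G.children u := huv
  rw [hw] at this ⊢
  rw [Set.mem_singleton_iff.1 this]

lemma IsDirectedTree.children_iterate_parent (hG : G.IsDirectedTree) {ω : V}
    (hone : ∀ v, v ≠ ω → (G.children v).encard = 1) {k j : ℕ} (h : G.ParentIterDefined k ω)
    (hj : j < k) : G.children (G.parent^[j + 1] ω) = {G.parent^[j] ω} := by
  refine children_eq_singleton (hone _ fun he => ?_) (h.adj hj)
  have := (h.mono (k := j + 1) hj).transGen
  rw [he] at this
  exact hG.not_transGen_self ω this

end Digraph

/-! ### The shift on the descendants of a vertex -/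

section Restrict

open Digraph

variable {V : Type*} {G : Digraph V} {lam : V → ℂ} {S : EllTwo V →L[ℂ] EllTwo V}

open Classical in
/-- Extension by zero, from functions on a set `W` to functions on `V`. -/
def zeroExtend {W : Set V} (f : W → ℂ) (v : V) : ℂ := if h : v ∈ W then f ⟨v, h⟩ else 0

lemma zeroExtend_of_mem {W : Set V} (f : W → ℂ) {v : V} (h : v ∈ W) :
    zeroExtend f v = f ⟨v, h⟩ := dif_pos h

lemma zeroExtend_of_notMem {W : Set V} (f : W → ℂ) {v : V} (h : v ∉ W) : zeroExtend f v = 0 :=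
  dif_neg h

lemma memℓp_zeroExtend {W : Set V} (f : EllTwo W) : Memℓp (zeroExtend f) 2 := by
  have h := (lp.hasSum_norm (p := 2) (by simp) f).summable
  refine memℓp_gen ((Subtype.val_injective.summable_iff fun v hv => ?_).1 (h.congr fun w => ?_))
  · rw [Subtype.range_coe] at hv
    rw [zeroExtend_of_notMem _ hv]
    simp
  · simp only [Function.comp_apply, zeroExtend_of_mem _ w.2]

/-- Extension by zero as an isometry of `ℓ²` spaces. -/
def extendLI (W : Set V) : EllTwo W →ₗᵢ[ℂ] EllTwo V where
  toFun f := ⟨zeroExtend f, memℓp_zeroExtend f⟩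
  map_add' f g := by
    ext v
    change zeroExtend _ v = zeroExtend _ v + zeroExtend _ v
    by_cases h : v ∈ W
    · simp only [zeroExtend_of_mem _ h]
      rfl
    · simp only [zeroExtend_of_notMem _ h, add_zero]
  map_smul' c f := by
    ext v
    change zeroExtend _ v = c * zeroExtend _ v
    by_cases h : v ∈ W
    · simp only [zeroExtend_of_mem _ h]
      rfl
    · simp only [zeroExtend_of_notMem _ h, mul_zero]
  norm_map' f := by
    have : ‖(⟨zeroExtend f, memℓp_zeroExtend f⟩ : EllTwo V)‖ₑ ^ 2 = ‖f‖ₑ ^ 2 := by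
      rw [EllTwo.enorm_sq_eq_tsum, EllTwo.enorm_sq_eq_tsum]
      change ∑' v, ‖zeroExtend f v‖ₑ ^ 2 = _
      rw [← Subtype.val_injective.tsum_eq (f := fun v => ‖zeroExtend f v‖ₑ ^ 2)]
      · exact tsum_congr fun w => by rw [zeroExtend_of_mem _ w.2]
      · intro v hv
        rw [Subtype.range_coe]
        by_contra h
        simp [zeroExtend_of_notMem _ h] at hv
    have h2 := congrArg ENNReal.toReal this
    simp only [ENNReal.toReal_pow, toReal_enorm] at h2
    exact (sq_eq_sq₀ (norm_nonneg _) (norm_nonneg _)).1 h2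

lemma extendLI_apply (W : Set V) (f : EllTwo W) (v : V) : extendLI W f v = zeroExtend f v := rfl

lemma extendLI_basisVec (W : Set V) (w : W) : extendLI W (basisVec w) = basisVec (w : V) := by
  ext v
  rw [extendLI_apply, basisVec_apply]
  by_cases h : v ∈ W
  · rw [zeroExtend_of_mem _ h, basisVec_apply]
    by_cases hw : v = w
    · rw [if_pos hw, if_pos (Subtype.ext hw)]
    · rw [if_neg hw, if_neg (mt (congrArg Subtype.val) hw)]
  · rw [zeroExtend_of_notMem _ h, if_neg]
    rintro rfl
    exact h w.2

lemma inner_basisVec_left (v : V) (f : EllTwo V) : inner ℂ (basisVec v) f = f v := by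
  classical
  rw [basisVec]
  convert lp.inner_single_left v (1 : ℂ) f
  simp

lemma adjoint_extendLI_apply (W : Set V) (g : EllTwo V) (w : W) :
    ContinuousLinearMap.adjoint (extendLI W).toContinuousLinearMap g w = g w := by
  rw [← inner_basisVec_left, ContinuousLinearMap.adjoint_inner_right]
  change inner ℂ (extendLI W (basisVec w)) g = _
  rw [extendLI_basisVec, inner_basisVec_left]

/-- The only delicate vertices are roots of the subtree that have a parent in `G`: that parent lies
outside the descendants, where the extension vanishes. -/
lemma shiftFun_zeroExtend (hG : G.IsDirectedTree) (u : V) (f : G.descendants u → ℂ) :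
    G.shiftFun lam (zeroExtend f) =
      zeroExtend ((G.restrictTo (G.descendants u)).shiftFun (fun v => lam v) f) := by
  funext v
  by_cases hv : v ∈ G.descendants u
  · rw [zeroExtend_of_mem _ hv]
    by_cases hr : (G.restrictTo (G.descendants u)).IsRoot ⟨v, hv⟩
    · rw [shiftFun, shiftFun, if_pos hr]
      split_ifs with hr'
      · rfl
      · rw [zeroExtend_of_notMem, mul_zero]
        intro hp
        exact hr ⟨_, hp⟩ (adj_parent hr')
    · have h := adj_parent hr
      have h' : G.Adj ((G.restrictTo (G.descendants u)).parent ⟨v, hv⟩) v := h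
      rw [hG.shiftFun_of_adj h', shiftFun, if_neg hr, zeroExtend_of_mem _ (Subtype.coe_prop _)]
  · rw [zeroExtend_of_notMem _ hv, shiftFun]
    split_ifs with hr
    · rfl
    · rw [zeroExtend_of_notMem, mul_zero]
      exact fun hp => hv (Relation.ReflTransGen.tail hp (adj_parent hr))

lemma exists_shift_descendants (hG : G.IsDirectedTree) (hS : G.IsWeightedShift lam S) (u : V) :
    ∃ T : EllTwo (G.descendants u) →L[ℂ] EllTwo (G.descendants u),
      (G.restrictTo (G.descendants u)).IsWeightedShift (fun v => lam v) T := by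
  -- The adjoint of extension by zero is restriction, so this is the compression of `S` to the
  -- subtree.
  refine ⟨ContinuousLinearMap.adjoint (extendLI _).toContinuousLinearMap ∘L S ∘L
    (extendLI _).toContinuousLinearMap, fun f v => ?_⟩
  rw [ContinuousLinearMap.comp_apply, adjoint_extendLI_apply, ContinuousLinearMap.comp_apply, hS]
  change G.shiftFun lam (zeroExtend f) v = _
  rw [shiftFun_zeroExtend hG, zeroExtend_of_mem _ v.2]

lemma norm_shift_descendants_pow (hG : G.IsDirectedTree) (hS : G.IsWeightedShift lam S) {u : V}
    {T : EllTwo (G.descendants u) →L[ℂ] EllTwo (G.descendants u)}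
    (hT : (G.restrictTo (G.descendants u)).IsWeightedShift (fun v => lam v) T) (n : ℕ)
    (f : EllTwo (G.descendants u)) : ‖(T ^ n) f‖ = ‖(S ^ n) (extendLI _ f)‖ := by
  have h1 : ∀ f, extendLI _ (T f) = S (extendLI _ f) := fun f => by
    ext v
    rw [hS, extendLI_apply]
    change _ = G.shiftFun lam (zeroExtend f) v
    rw [shiftFun_zeroExtend hG, show (T f : G.descendants u → ℂ) = _ from funext (hT f)]
  induction n generalizing f with
  | zero => exact ((extendLI _).norm_map f).symm
  | succ n ih =>
    rw [pow_succ S n, pow_succ T n, ContinuousLinearMap.mul_def, ContinuousLinearMap.mul_def,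
      ContinuousLinearMap.comp_apply, ContinuousLinearMap.comp_apply, ih, h1]

lemma shiftOnDescendantsCH_of_isCompletelyHyperexpansive (hG : G.IsDirectedTree)
    (hS : G.IsWeightedShift lam S) (h : IsCompletelyHyperexpansive S) (u : V) :
    G.ShiftOnDescendantsCH lam u := by
  obtain ⟨T, hT⟩ := exists_shift_descendants hG hS u
  refine ⟨T, hT, fun f => ?_⟩
  simp only [norm_shift_descendants_pow hG hS hT]
  exact h _

lemma Digraph.ShiftOnDescendantsCH.completelyAlternating (hG : G.IsDirectedTree)
    (hS : G.IsWeightedShift lam S) {u : V} (h : G.ShiftOnDescendantsCH lam u) {v : V}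
    (hv : v ∈ G.descendants u) : CompletelyAlternating (orbitSeq S v) := by
  obtain ⟨T, hT, hCH⟩ := h
  have := hCH (basisVec ⟨v, hv⟩)
  simp only [norm_shift_descendants_pow hG hS hT, extendLI_basisVec] at this
  exact this

end Restrict

/-! ### Complete hyperexpansivity on trees with one branching vertex -/

section OneBranching

open Digraph

variable {V : Type*} {G : Digraph V} {lam : V → ℂ} {S : EllTwo V →L[ℂ] EllTwo V} {ω : V}

lemma CompletelyAlternating.le_succ {a : ℕ → ℝ} (h : CompletelyAlternating a) (n : ℕ) :
    a n ≤ a (n + 1) := by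
  have := h n 1 le_rfl
  simp [Finset.sum_range_succ] at this
  linarith

lemma CompletelyAlternating.increment_le {a : ℕ → ℝ} (h : CompletelyAlternating a) (n : ℕ) :
    a (n + 2) - a (n + 1) ≤ a (n + 1) - a n := by
  have := h n 2 (by norm_num)
  simp [Finset.sum_range_succ] at this
  linarith

/-- The increments decrease, so each of the first `n` is at least the next one. -/
lemma CompletelyAlternating.mul_increment_le {a : ℕ → ℝ} (h : CompletelyAlternating a) (n : ℕ) :
    n * (a (n + 1) - a n) ≤ a n - a 0 := by
  induction n with
  | zero => simp
  | succ n ih =>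
    have h1 := mul_le_mul_of_nonneg_left (h.increment_le n) (by positivity : (0 : ℝ) ≤ n + 1)
    push_cast
    rw [show n + 1 + 1 = n + 2 from rfl]
    linarith

lemma CompletelyAlternating.eq_of_one_eq_zero {a : ℕ → ℝ} (h : CompletelyAlternating a)
    (h1 : a 1 = a 0) (n : ℕ) : a n = a 0 := by
  have hinc : ∀ n, a (n + 1) - a n ≤ 0 := fun n => by
    induction n with
    | zero => simp [h1]
    | succ n ih => exact (h.increment_le n).trans ih
  induction n with
  | zero => rfl
  | succ n ih => linarith [hinc n, h.le_succ n]

lemma completelyAlternating_const (c : ℝ) : CompletelyAlternating fun _ => c :=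
  (completelyAlternating_iff_exists_isRepresentingMeasure _).2 ⟨0, inferInstance, by simp⟩

lemma isCompletelyHyperexpansive_of_isometry (h : Isometry S) : IsCompletelyHyperexpansive S := by
  intro f
  have hS : ∀ g, ‖S g‖ = ‖g‖ := fun g => by
    simpa using h.dist_eq g 0
  have : ∀ n, ‖(S ^ n) f‖ = ‖f‖ := fun n => by
    induction n with
    | zero => simp
    | succ n ih => rw [pow_succ' S n, ContinuousLinearMap.mul_def, ContinuousLinearMap.comp_apply,
        hS, ih]
  simp only [this]
  exact completelyAlternating_const _

variable (hG : G.IsDirectedTree) (hS : G.IsWeightedShift lam S)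
include hG hS

lemma isometry_of_orbitSeq_one (h : ∀ v, orbitSeq S v 1 = 1) : Isometry S := by
  refine AddMonoidHomClass.isometry_of_norm S fun f => ?_
  have h0 := hasSum_norm_shift_pow_sq hG hS 0 f
  have h1 := hasSum_norm_shift_pow_sq hG hS 1 f
  simp only [h, orbitSeq_zero] at h0 h1
  have := h1.unique h0
  rw [pow_zero, pow_one, sq_eq_sq₀ (norm_nonneg _) (norm_nonneg _)] at this
  exact this

/-- Both `∑ |λ_w|²` and `∑ |λ_w|² ‖S e_w‖²` over the children of `p` equal `1`, while every `‖S e_w‖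
≥ 1`; a strict inequality at `v` would separate the sums. -/
lemma orbitSeq_child_of_orbitSeq_eq_one {p v : V} (hpv : G.Adj p v) (hv : lam v ≠ 0)
    (hCA : ∀ v, CompletelyAlternating (orbitSeq S v)) (hp : ∀ n, orbitSeq S p n = 1) :
    orbitSeq S v 1 = 1 := by
  refine le_antisymm ?_ ((orbitSeq_zero S v).symm.trans_le ((hCA v).le_succ 0))
  by_contra! hlt
  have h1 := orbitSeq_succ hG hS 0 p
  have h2 := orbitSeq_succ hG hS 1 p
  simp only [hp, orbitSeq_zero, ENNReal.ofReal_one, mul_one] at h1 h2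
  have hmono : ∀ w, 1 ≤ ENNReal.ofReal (orbitSeq S w 1) := fun w => by
    rw [ENNReal.one_le_ofReal, ← orbitSeq_zero S w]
    exact (hCA w).le_succ 0
  refine absurd (h1.symm.trans h2) (ne_of_lt ?_)
  refine ENNReal.tsum_lt_tsum (i := ⟨v, hpv⟩) (by rw [← h1]; exact ENNReal.one_ne_top)
    (fun w => le_mul_of_one_le_right' (hmono w)) ?_
  have hlt' : 1 < ENNReal.ofReal (orbitSeq S v 1) := by rwa [ENNReal.one_lt_ofReal]
  simpa using ENNReal.mul_lt_mul_right (a := ‖lam v‖ₑ ^ 2) (by simpa using hv) (by simp) hlt'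

lemma orbitSeq_iterate_parent {v : V} {k : ℕ}
    (hsing : ∀ j < k, G.children (G.parent^[j + 1] v) = {G.parent^[j] v}) (n : ℕ) :
    orbitSeq S (G.parent^[k] v) (n + k) =
      orbitSeq S (G.parent^[k] v) k * orbitSeq S v n := by
  have h : ∃ c, ∀ n, orbitSeq S (G.parent^[k] v) (n + k) = c * orbitSeq S v n := by
    induction k with
    | zero => exact ⟨1, fun n => by simp⟩
    | succ k ih =>
      obtain ⟨c, hc⟩ := ih fun j hj => hsing j (by omega)
      refine ⟨‖lam (G.parent^[k] v)‖ ^ 2 * c, fun n => ?_⟩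
      rw [← add_assoc, orbitSeq_succ_of_children_eq_singleton hG hS (hsing k (by omega)), hc,
        mul_assoc]
  obtain ⟨c, hc⟩ := h
  have h0 := hc 0
  rw [zero_add, orbitSeq_zero, mul_one] at h0
  rw [hc, h0]

/-- Let `x = ‖S ^ k e_p‖²` for the ancestor `p` at distance `k`, and `d = ‖S e_v‖² - 1`. The
increment of the sequence of `p` at `k` is `x * d`, so `k * x * d ≤ x - 1`. This fails once `k * d >
1`. -/
lemma orbitSeq_one_of_single_children {v : V}
    (hCA : ∀ v, CompletelyAlternating (orbitSeq S v))
    (hsing : ∀ j, G.children (G.parent^[j + 1] v) = {G.parent^[j] v}) :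
    orbitSeq S v 1 = 1 := by
  have h1 : 1 ≤ orbitSeq S v 1 := (orbitSeq_zero S v).symm.trans_le ((hCA v).le_succ 0)
  refine le_antisymm ?_ h1
  by_contra! hlt
  obtain ⟨k, hk⟩ := exists_nat_gt (orbitSeq S v 1 - 1)⁻¹
  have hd : 0 < orbitSeq S v 1 - 1 := by linarith
  have hk' : 1 < k * (orbitSeq S v 1 - 1) := by rwa [inv_lt_iff_one_lt_mul₀ hd] at hk
  have h2 := (hCA (G.parent^[k] v)).mul_increment_le k
  have h3 := orbitSeq_iterate_parent hG hS (k := k) (fun j _ => hsing j) 1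
  rw [add_comm 1 k] at h3
  rw [h3, orbitSeq_zero] at h2
  nlinarith [orbitSeq_nonneg S (G.parent^[k] v) k]

lemma isometry_of_rootless (hone : ∀ v, v ≠ ω → (G.children v).encard = 1)
    (hlam : ∀ v, lam v ≠ 0) (hroot : ∀ v, ¬ G.IsRoot v)
    (hCA : ∀ v, CompletelyAlternating (orbitSeq S v)) : Isometry S := by
  refine isometry_of_orbitSeq_one hG hS fun v => ?_
  have hdef : ∀ k v, G.ParentIterDefined k v := fun k v j _ => hroot _
  -- Vertices that are not proper descendants of `ω`, including `ω` itself, have unbranched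
  -- ancestry.
  have hnd : ∀ v, (∀ j, G.parent^[j + 1] v ≠ ω) → orbitSeq S v 1 = 1 := fun v hv =>
    orbitSeq_one_of_single_children hG hS hCA fun j =>
      children_eq_singleton (hone _ (hv j)) ((hdef (j + 1) v).adj (Nat.lt_succ_self j))
  -- The remaining vertices are reached by induction on their distance below `ω`.
  have hdes : ∀ k v, G.parent^[k] v = ω → orbitSeq S v 1 = 1 := by
    intro k
    induction k with
    | zero =>
      rintro v rfl
      refine hnd _ fun j hj => ?_
      have := (hdef (j + 1) v).transGen
      rw [hj] at this
      exact hG.not_transGen_self _ this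
    | succ k ih =>
      intro v hv
      rw [Function.iterate_succ_apply] at hv
      refine orbitSeq_child_of_orbitSeq_eq_one hG hS (adj_parent (hroot v)) (hlam v) hCA fun n => ?_
      rw [(hCA _).eq_of_one_eq_zero (by rw [ih _ hv, orbitSeq_zero]), orbitSeq_zero]
  by_cases h : ∃ j, G.parent^[j + 1] v = ω
  · obtain ⟨j, hj⟩ := h
    exact hdes _ v hj
  · exact hnd v fun j hj => h ⟨j, hj⟩

/-- Dropping the first term passes the property to an only child. This fails just at `ω`, whose
children are covered by hypothesis. -/
lemma completelyAlternating_of_root (hone : ∀ v, v ≠ ω → (G.children v).encard = 1)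
    (hlam : ∀ v, ¬ G.IsRoot v → lam v ≠ 0) {r : V} (hr : G.IsRoot r)
    (hrCA : CompletelyAlternating (orbitSeq S r))
    (hch : ∀ v ∈ G.children ω, CompletelyAlternating (orbitSeq S v)) (v : V) :
    CompletelyAlternating (orbitSeq S v) := by
  induction hG.reflTransGen_root hr v with
  | refl => exact hrCA
  | @tail b c _ hbc ih =>
    by_cases hb : b = ω
    · exact hch c (hb ▸ hbc)
    · exact completelyAlternating_child hG hS (children_eq_singleton (hone b hb) hbc)
        (hlam c fun h => h b hbc) ih

/-- The conditions on the weights along the path from the root to `ω`. -/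
lemma weights_of_completelyAlternating (hone : ∀ v, v ≠ ω → (G.children v).encard = 1)
    (hlam : ∀ v, ¬ G.IsRoot v → lam v ≠ 0) {κ : ℕ} (hκ : 0 < κ) (hdef : G.ParentIterDefined κ ω)
    (hCA : ∀ v, CompletelyAlternating (orbitSeq S v)) :
    StronglyConsistentAt G lam S ω ∧
      (∀ k : ℕ, 1 ≤ k → k ≤ κ - 1 →
        ‖lam (G.parent^[k - 1] ω)‖ₑ ^ 2 =
          1 + ‖∏ j ∈ Finset.range k, lam (G.parent^[j] ω)‖ₑ ^ 2 *
            childMoment G lam S ω (k + 1)) ∧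
      1 + ‖∏ j ∈ Finset.range κ, lam (G.parent^[j] ω)‖ₑ ^ 2 * childMoment G lam S ω (κ + 1) ≤
        ‖lam (G.parent^[κ - 1] ω)‖ₑ ^ 2 := by
  have hsing := fun j (hj : j < κ) => hG.children_iterate_parent hone hdef hj
  -- Each of these vertices has a parent, so its measure has no atom at `0`. The vertex with index
  -- `κ` is not included, and there only the inequality is obtained.
  have hstrong : ∀ j < κ, StronglyConsistentAt G lam S (G.parent^[j] ω) := fun j hj =>
    stronglyConsistentAt_of_adj hG hS (hdef.adj hj) (hlam _ (hdef j hj)) hCA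
  have hmom : ∀ j < κ, ∀ m, childMoment G lam S (G.parent^[j] ω) (m + 1) =
      ∫⁻ s, (ENNReal.ofReal (s : ℝ) ^ m)⁻¹ ∂(tau S (G.parent^[j] ω)) := fun j hj =>
    childMoment_succ_of_tau_zero hG hS (fun v _ => hCA v) (hCA _)
      ((stronglyConsistentAt_iff hG hS (fun v _ => hCA v) (hCA _)).1 (hstrong j hj))
  have hsum : ∀ k < κ, ∑' v : G.children (G.parent^[k + 1] ω), ‖lam v‖ₑ ^ 2 =
      ‖lam (G.parent^[k] ω)‖ₑ ^ 2 := fun k hk =>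
    tsum_children_of_eq_singleton (hsing k hk) fun v => ‖lam v‖ₑ ^ 2
  have hmoment : ∀ k ≤ κ, childMoment G lam S (G.parent^[k] ω) 1 =
      ‖∏ j ∈ Finset.range k, lam (G.parent^[j] ω)‖ₑ ^ 2 * childMoment G lam S ω (k + 1) :=
    fun k hk => childMoment_iterate_parent (fun j hj => hsing j (by omega))
      (fun j hj => hmom j (by omega)) 1
  refine ⟨hstrong 0 hκ, fun k hk1 hk => ?_, ?_⟩
  · obtain ⟨k, rfl⟩ := Nat.exists_eq_add_of_le' hk1
    have := hstrong (k + 1) (by omega)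
    rwa [StronglyConsistentAt, hsum k (by omega), hmoment (k + 1) (by omega)] at this
  · obtain ⟨κ, rfl⟩ := Nat.exists_eq_add_of_le' hκ
    have := consistentAt_of_completelyAlternating hG hS (u := G.parent^[κ + 1] ω)
      (fun v _ => hCA v) (hCA _)
    rwa [ConsistentAt, hsum κ (by omega), hmoment (κ + 1) le_rfl] at this

/-- The weight condition at each level is the consistency condition at that ancestor of `ω`,
rewritten through moments at `ω`. The absence of an atom at `0` is carried along because the
rewriting at the next level needs it. -/
lemma completelyAlternating_iterate_parent_of_weights
    (hone : ∀ v, v ≠ ω → (G.children v).encard = 1) {κ : ℕ} (hdef : G.ParentIterDefined κ ω)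
    (hω : CompletelyAlternating (orbitSeq S ω))
    (hch : ∀ v ∈ G.children ω, CompletelyAlternating (orbitSeq S v))
    (hstrong : StronglyConsistentAt G lam S ω)
    (heq : ∀ k : ℕ, 1 ≤ k → k ≤ κ - 1 →
      ‖lam (G.parent^[k - 1] ω)‖ₑ ^ 2 =
        1 + ‖∏ j ∈ Finset.range k, lam (G.parent^[j] ω)‖ₑ ^ 2 * childMoment G lam S ω (k + 1))
    (hle : 1 + ‖∏ j ∈ Finset.range κ, lam (G.parent^[j] ω)‖ₑ ^ 2 *
      childMoment G lam S ω (κ + 1) ≤ ‖lam (G.parent^[κ - 1] ω)‖ₑ ^ 2) (k : ℕ) (hk : k ≤ κ) :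
    CompletelyAlternating (orbitSeq S (G.parent^[k] ω)) ∧
      (k < κ → tau S (G.parent^[k] ω) {0} = 0) := by
  have hsing := fun j (hj : j < κ) => hG.children_iterate_parent hone hdef hj
  -- The moment formula at one level uses the absence of atoms at all lower levels.
  induction k using Nat.strong_induction_on with
  | _ k ih =>
  cases k with
  | zero => exact ⟨hω, fun _ => (stronglyConsistentAt_iff hG hS hch hω).1 hstrong⟩
  | succ k =>
    have hchild : ∀ j ≤ k + 1, ∀ v ∈ G.children (G.parent^[j] ω),
        CompletelyAlternating (orbitSeq S v) := by
      intro j hj v hv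
      cases j with
      | zero => exact hch v hv
      | succ j =>
        rw [hsing j (by omega), Set.mem_singleton_iff] at hv
        rw [hv]
        exact (ih j (by omega) (by omega)).1
    have hmoment : childMoment G lam S (G.parent^[k + 1] ω) 1 =
        ‖∏ j ∈ Finset.range (k + 1), lam (G.parent^[j] ω)‖ₑ ^ 2 *
          childMoment G lam S ω (k + 1 + 1) :=
      childMoment_iterate_parent (fun j hj => hsing j (by omega)) (fun j hj =>
        childMoment_succ_of_tau_zero hG hS (hchild j (by omega)) (ih j hj (by omega)).1
          ((ih j hj (by omega)).2 (by omega))) 1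
    have hsum : ∑' v : G.children (G.parent^[k + 1] ω), ‖lam v‖ₑ ^ 2 =
        ‖lam (G.parent^[k] ω)‖ₑ ^ 2 :=
      tsum_children_of_eq_singleton (hsing k (by omega)) fun v => ‖lam v‖ₑ ^ 2
    have hst : k + 1 < κ → StronglyConsistentAt G lam S (G.parent^[k + 1] ω) := fun h => by
      rw [StronglyConsistentAt, hsum, hmoment]
      exact heq (k + 1) (by omega) (by omega)
    have hcons : ConsistentAt G lam S (G.parent^[k + 1] ω) := by
      rcases hk.lt_or_eq with h | rfl
      · exact (hst h).ge
      · rw [ConsistentAt, hsum, hmoment]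
        exact hle
    have hCA := completelyAlternating_of_consistentAt hG hS (hchild (k + 1) le_rfl) hcons
    exact ⟨hCA, fun h => (stronglyConsistentAt_iff hG hS (hchild (k + 1) le_rfl) hCA).1 (hst h)⟩

end OneBranching

end

theorem mainTheorem10 {V : Type*} (G : Digraph V) (hG : G.IsDirectedTree)
    (ω : V) (hω : 2 ≤ (G.children ω).encard)
    (hone : ∀ v, v ≠ ω → (G.children v).encard = 1)
    (lam : V → ℂ) (hlam : ∀ v, ¬ G.IsRoot v → lam v ≠ 0)
    (S : EllTwo V →L[ℂ] EllTwo V) (hS : G.IsWeightedShift lam S) :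
    -- the branching vertex is the root
    (G.IsRoot ω →
      (IsCompletelyHyperexpansive S ↔
        (∀ v ∈ G.children ω, CompletelyAlternating (orbitSeq S v)) ∧
          ConsistentAt G lam S ω)) ∧
    -- the tree has a root, different from the branching vertex
    (∀ root, G.IsRoot root → ω ≠ root →
      (∃! κ : ℕ, 0 < κ ∧ G.ParentIterDefined κ ω ∧ G.parent^[κ] ω = root) ∧
      ∀ κ : ℕ, 0 < κ → G.ParentIterDefined κ ω → G.parent^[κ] ω = root →
        List.TFAE
          [IsCompletelyHyperexpansive S,
            G.ShiftOnDescendantsCH lam ω ∧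
              StronglyConsistentAt G lam S ω ∧
              (∀ k : ℕ, 1 ≤ k → k ≤ κ - 1 →
                ‖lam (G.parent^[k - 1] ω)‖ₑ ^ 2 =
                  1 + ‖∏ j ∈ Finset.range k, lam (G.parent^[j] ω)‖ₑ ^ 2 *
                    childMoment G lam S ω (k + 1)) ∧
              1 + ‖∏ j ∈ Finset.range κ, lam (G.parent^[j] ω)‖ₑ ^ 2 *
                  childMoment G lam S ω (κ + 1) ≤
                ‖lam (G.parent^[κ - 1] ω)‖ₑ ^ 2,
            CompletelyAlternating (orbitSeq S root) ∧
              ∀ v ∈ G.children ω, CompletelyAlternating (orbitSeq S v)]) ∧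
    -- the tree is rootless
    ((∀ v, ¬ G.IsRoot v) → (IsCompletelyHyperexpansive S ↔ Isometry S)) := by
  have hCH := isCompletelyHyperexpansive_iff_orbitSeq hG hS
  refine ⟨fun hr => ?_, fun root hroot hne => ⟨hG.existsUnique_depth hroot hne, ?_⟩, fun hr => ?_⟩
  · rw [hCH]
    exact ⟨fun h => ⟨fun v _ => h v,
        consistentAt_of_completelyAlternating hG hS (fun v _ => h v) (h ω)⟩,
      fun h => completelyAlternating_of_root hG hS hone hlam hr
        (completelyAlternating_of_consistentAt hG hS h.1 h.2) h.1⟩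
  · intro κ hκ hdef hκr
    tfae_have 1 → 2 := fun h => ⟨shiftOnDescendantsCH_of_isCompletelyHyperexpansive hG hS h ω,
      weights_of_completelyAlternating hG hS hone hlam hκ hdef (hCH.1 h)⟩
    tfae_have 2 → 3 := fun ⟨hT, hstrong, heq, hle⟩ => by
      have hch : ∀ v ∈ G.children ω, CompletelyAlternating (orbitSeq S v) := fun v hv =>
        hT.completelyAlternating hG hS (Relation.ReflTransGen.single hv)
      have := (completelyAlternating_iterate_parent_of_weights hG hS hone hdef
        (hT.completelyAlternating hG hS Relation.ReflTransGen.refl) hch hstrong heq hle κ le_rfl).1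
      rw [hκr] at this
      exact ⟨this, hch⟩
    tfae_have 3 → 1 := fun h =>
      hCH.2 (completelyAlternating_of_root hG hS hone hlam hroot h.1 h.2)
    tfae_finish
  · exact ⟨fun h => isometry_of_rootless hG hS hone (fun v => hlam v (hr v)) hr (hCH.1 h),
      isCompletelyHyperexpansive_of_isometry⟩
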